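/- All graphs are finite and simple. For a graph $G$ with node set $V$, let $\mathrm{STAB}(G)\subseteq\mathbb R^V$ be the convex hull of the characteristic vectors of the stable sets of $G$, let $\alpha(G)$ be the maximum size of a stable set, let $\delta_G(v)$ be the degree of $v$, and let $\mathrm{FRAC}(G)=\{x\in[0,1]^V: x_u+x_v\le 1 \text{ for every edge } uv\}$ be the edge relaxation. For $K\subseteq[0,1]^n$ let $\mathrm{cone}(K)=\{(x_0,x_0y)\in\mathbb R^{n+1}: x_0\ge 0,\ y\in K\}$, and let $M_+(K)$ be the set of symmetric positive semidefinite real matrices $Y$ of order $n+1$ (rows and columns indexed by $0,1,\dots,n$) such that $Ye_0=\mathrm{diag}(Y)$ and, for every $i\in\{1,\dots,n\}$, $Ye_i\in\mathrm{cone}(K)$ and $Y(e_0-e_i)\in\mathrm{cone}(K)$. Let $$\mathrm{LS}_+(K)=\{x\in[0,1]^n : (1,x)=Ye_0 \text{ for some } Y\in M_+(K)\}.$$ A graph $G$ is called $\mathrm{LS}_+$-perfect if $\mathrm{LS}_+(\mathrm{FRAC}(G))=\mathrm{STAB}(G)$. If $G'$ is a graph and $v_0$ a node of $G'$ such that $G'-v_0$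 is a cycle and $v_0$ has at least two neighbours, then the central cycles of $G'$ (with respect to $v_0$) are the cycles formed by $v_0$ and an arc of $G'-v_0$ that joins two distinct cyclically consecutive neighbours of $v_0$ and has no neighbour of $v_0$ in its interior (one central cycle for each such arc). A central cycle is odd if its number of nodes is odd. **Corollary.** Let $G$ be an $\mathrm{LS}_+$-perfect graph. Then there is no node induced subgraph $G'$ of $G$ such that, for some node $v_0$ of $G'$ and some integer $k\ge 2$, one of the following holds: 1. $G'-v_0$ is isomorphic to the cycle $C_{2k+1}$, $2\le\delta_{G'}(v_0)\le 2k$, and $G'$ has at least two odd central cycles; or 2. $G'-v_0$ is isomorphic to the complement $\overline{C_{2k+1}}$, $k+1\le\delta_{G'}(v_0)\le 2k$, and $\alpha(G')=2$. -/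

import Mathlib

namespace LovaszSchrijver

section Operator

variable {ι : Type*}

/-- The homogenization `cone(K) ⊆ ℝ^{n+1}` of a set `K ⊆ [0,1]^n`. The coordinates of `ℝ^n` are
indexed by `ι`, those of `ℝ^{n+1}` by `Option ι`, where `none` is the extra coordinate `0`. -/
def homCone (K : Set (ι → ℝ)) : Set (Option ι → ℝ) :=
  {z | 0 ≤ z none ∧ ∃ y ∈ K, ∀ i, z (some i) = z none * y i}

/-- The vector `(1, x)` of `ℝ^{n+1}`. -/
def homVec (x : ι → ℝ) : Option ι → ℝ
  | none => 1
  | some i => x i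

variable [Fintype ι] [DecidableEq ι]

/-- The `i`-th vector of the canonical basis of `ℝ^{n+1}`. -/
def basisVec (i : Option ι) : Option ι → ℝ := Pi.single i 1

/-- The set `M(K)` of symmetric `(n+1) × (n+1)` matrices `Y` with `Y e₀ = diag Y`,
`Y e_i ∈ cone(K)` and `Y (e₀ - e_i) ∈ cone(K)` for `i = 1, …, n`. -/
def liftM (K : Set (ι → ℝ)) : Set (Matrix (Option ι) (Option ι) ℝ) :=
  {Y | Y.IsSymm ∧
    Y.mulVec (basisVec none) = Y.diag ∧
    ∀ i : ι, Y.mulVec (basisVec (some i)) ∈ homCone K ∧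
      Y.mulVec (basisVec none - basisVec (some i)) ∈ homCone K}

/-- `M₊(K)`: the positive semidefinite matrices in `M(K)`. -/
def liftMPlus (K : Set (ι → ℝ)) : Set (Matrix (Option ι) (Option ι) ℝ) :=
  {Y | Y ∈ liftM K ∧ Y.PosSemidef}

/-- The Lovász–Schrijver relaxation `LS₊(K)`. -/
def LSPlus (K : Set (ι → ℝ)) : Set (ι → ℝ) :=
  {x | (∀ i, 0 ≤ x i ∧ x i ≤ 1) ∧ ∃ Y ∈ liftMPlus K, homVec x = Y.mulVec (basisVec none)}

end Operator

section Graph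

variable {V : Type*}

/-- The stable set polytope: the convex hull of the characteristic vectors of stable sets. -/
def stableSetPolytope (G : SimpleGraph V) : Set (V → ℝ) :=
  convexHull ℝ {x | ∃ S : Set V, G.IsIndepSet S ∧ x = S.indicator 1}

/-- The edge relaxation: the points of `[0,1]^V` with `x_u + x_v ≤ 1` for every edge `uv`. -/
def edgeRelaxation (G : SimpleGraph V) : Set (V → ℝ) :=
  {x | (∀ v, 0 ≤ x v ∧ x v ≤ 1) ∧ ∀ u v, G.Adj u v → x u + x v ≤ 1}

/-- `G` is `LS₊`-perfect if `LS₊`, applied to the edge relaxation, gives the stable set polytope. -/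
def IsLSPlusPerfect [Fintype V] [DecidableEq V] (G : SimpleGraph V) : Prop :=
  LSPlus (edgeRelaxation G) = stableSetPolytope G

/-- The positions met when going forward around the cycle from `i` to `j`, both included
(subtraction in `Fin n` is modulo `n`). -/
def cyclicArc {n : ℕ} (i j : Fin n) : Set (Fin n) := {w | w - i ≤ j - i}

/-- Let `H - v₀` be a cycle `C_n`, with labelling `φ`. The central cycles of `H`, given by their
node sets: one for each pair of (distinct) cyclically consecutive neighbours `i`, `j` of `v₀` on the
cycle, made of the nodes of the arc from `i` to `j` together with `v₀`. -/
def centralCycles (H : SimpleGraph V) (v₀ : V) {n : ℕ}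
    (φ : SimpleGraph.cycleGraph n ≃g H.induce ({v₀}ᶜ : Set V)) : Set (Set V) :=
  {D | ∃ i j : Fin n, i ≠ j ∧ H.Adj v₀ (φ i) ∧ H.Adj v₀ (φ j) ∧
    (∀ w ∈ cyclicArc i j, H.Adj v₀ (φ w) → w = i ∨ w = j) ∧
    D = insert v₀ ((fun w => (φ w : V)) '' cyclicArc i j)}

/-- `H - v₀ = C_{2k+1}`, `2 ≤ δ(v₀) ≤ 2k`, and `H` has at least two odd central cycles. -/
def IsCycleObstruction (H : SimpleGraph V) (v₀ : V) (k : ℕ) : Prop :=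
  ∃ φ : SimpleGraph.cycleGraph (2 * k + 1) ≃g H.induce ({v₀}ᶜ : Set V),
    2 ≤ (H.neighborSet v₀).ncard ∧ (H.neighborSet v₀).ncard ≤ 2 * k ∧
    2 ≤ {D | D ∈ centralCycles H v₀ φ ∧ Odd D.ncard}.ncard

/-- `H - v₀` is the complement of `C_{2k+1}`, `k + 1 ≤ δ(v₀) ≤ 2k`, and `α(H) = 2`. -/
def IsAntiholeObstruction (H : SimpleGraph V) (v₀ : V) (k : ℕ) : Prop :=
  Nonempty ((SimpleGraph.cycleGraph (2 * k + 1))ᶜ ≃g H.induce ({v₀}ᶜ : Set V)) ∧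
    k + 1 ≤ (H.neighborSet v₀).ncard ∧ (H.neighborSet v₀).ncard ≤ 2 * k ∧
    H.indepNum = 2

end Graph

end LovaszSchrijver

namespace LovaszSchrijver

/-! ### Homogenized edge relaxation and substitution of literals -/

section General

variable {V W : Type*}

/-! A graph fails to be `LS₊`-perfect as soon as some point of `LSPlus` violates an inequality valid
for all stable sets. Explicit points are needed only for two families: the odd wheel with one spoke
removed, against ∑ rim + (k - 1) hub ≤ k, and the complement of an odd cycle with a hub missing one
node, against ∑ all ≤ 2, both for k ≥ 2.

These points come from a perturbation, `exists_mem_LSPlus_lt`. Let A be the average of the rank-one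
matrices (1, χ_S)(1, χ_S)ᵀ over a family of stable sets S tight for a · x ≤ b. If the family
determines the inequality, the kernel of A is spanned by (-b, a). Hence A + εZ is positive
semidefinite for small ε > 0 once the form of the bordered Z is positive at (-b, a). The linear
constraints survive if each of them either has slack at some tight set or is not decreased by Z. The
diagonal then violates the inequality when a · diag Z > 0. The directions `wheelDir` and
`antiwheelDir` have row sum 0 in every row but row 0, so the condition at (-b, a) becomes 2k < 4k -
3 and 4 < 5, respectively.

Other graphs reduce to these by `LSPlus_edgeRelaxation_subst`: replacing each variable by 0, x_a or
1 - x_a maps `LSPlus` of the base graph into `LSPlus` of the new graph, provided literals on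
adjacent nodes sum to at most 1. Missing edges cost nothing, so a hub with fewer spokes is harmless.
The antihole case uses the identity substitution, and α = 2 makes the inequality valid. In the cycle
case, a walk around the rim absorbs pairs of consecutive nodes as 1 - x, x and maps the rest to a
wheel with rim of length 2K + 1. Each odd central cycle ends at a node where the walk advances
(`walkAdvance_of_odd_arc`). Two advances bring the final position to at least 3, and it is even, so
K ≥ 2 (`not_isLSPlusPerfect_of_wheel`). -/

lemma mem_homCone_edgeRelaxation {G : SimpleGraph V} {z : Option V → ℝ} :
    z ∈ homCone (edgeRelaxation G) ↔ 0 ≤ z none ∧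
      (∀ v, 0 ≤ z (some v) ∧ z (some v) ≤ z none) ∧
      ∀ u v, G.Adj u v → z (some u) + z (some v) ≤ z none := by
  constructor
  · rintro ⟨h0, y, ⟨hy, he⟩, hz⟩
    refine ⟨h0, fun v => ?_, fun u v huv => ?_⟩
    · rw [hz]
      exact ⟨mul_nonneg h0 (hy v).1, mul_le_of_le_one_right h0 (hy v).2⟩
    · rw [hz, hz, ← mul_add]
      exact mul_le_of_le_one_right h0 (he u v huv)
  · rintro ⟨h0, hb, he⟩
    -- If the homogenizing coordinate is 0, the bounds force z = 0 and any point of the relaxation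
    -- serves as y.
    rcases h0.eq_or_lt with h | h
    · refine ⟨h0, 0, ⟨by simp, by simp⟩, fun v => ?_⟩
      have := hb v
      simp only [← h] at this ⊢
      linarith
    · refine ⟨h0, fun v => z (some v) / z none, ⟨fun v => ?_, fun u v huv => ?_⟩, fun v => ?_⟩
      · exact ⟨div_nonneg (hb v).1 h0, (div_le_one h).2 (hb v).2⟩
      · rw [← add_div]
        exact (div_le_one h).2 (he u v huv)
      · field_simp

/-- A literal over `W` is `0`, a variable `a` or a negated variable `1 - a`. -/
inductive Literal (W : Type*)
  | zero : Literal W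
  | pos : W → Literal W
  | neg : W → Literal W

/-- The value of a literal at a point of the homogenized space. -/
def Literal.eval (z : Option W → ℝ) : Literal W → ℝ
  | zero => 0
  | pos a => z (some a)
  | neg a => z none - z (some a)

/-- Two literals that may be put on the ends of an edge. -/
def Literal.Compatible (B : SimpleGraph W) : Literal W → Literal W → Prop
  | zero, _ => True
  | _, zero => True
  | pos a, pos b => B.Adj a b
  | pos a, neg b => a = b
  | neg a, pos b => a = b
  | neg _, neg _ => False

lemma homCone_edgeRelaxation_add {B : SimpleGraph W} {y z : Option W → ℝ}
    (hy : y ∈ homCone (edgeRelaxation B)) (hz : z ∈ homCone (edgeRelaxation B)) :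
    y + z ∈ homCone (edgeRelaxation B) := by
  rw [mem_homCone_edgeRelaxation] at hy hz ⊢
  refine ⟨add_nonneg hy.1 hz.1, fun v => ?_, fun u v huv => ?_⟩
  · have := hy.2.1 v
    have := hz.2.1 v
    simp only [Pi.add_apply]
    constructor <;> linarith
  · have := hy.2.2 u v huv
    have := hz.2.2 u v huv
    simp only [Pi.add_apply]
    linarith

variable [Fintype W] [DecidableEq W]

/-- The coefficient vector of a literal. -/
def Literal.vec : Literal W → (Option W → ℝ)
  | zero => 0
  | pos a => basisVec (some a)
  | neg a => basisVec none - basisVec (some a)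

lemma dotProduct_basisVec (z : Option W → ℝ) (a : Option W) : z ⬝ᵥ basisVec a = z a := by
  simp [basisVec]

lemma basisVec_dotProduct (z : Option W → ℝ) (a : Option W) : basisVec a ⬝ᵥ z = z a := by
  simp [basisVec]

lemma Literal.vec_dotProduct (l : Literal W) (z : Option W → ℝ) : l.vec ⬝ᵥ z = l.eval z := by
  cases l <;> simp [Literal.vec, Literal.eval, basisVec_dotProduct, sub_dotProduct]

/-- The matrix of the substitution of literals for the variables. -/
def substMatrix (L : V → Literal W) : Matrix (Option V) (Option W) ℝ
  | none => basisVec none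
  | some v => (L v).vec

lemma substMatrix_mulVec (L : V → Literal W) (z : Option W → ℝ) :
    (substMatrix L).mulVec z = fun o => o.elim (z none) fun v => (L v).eval z := by
  funext o
  cases o with
  | none => simp [Matrix.mulVec, substMatrix, basisVec_dotProduct]
  | some v => simp [Matrix.mulVec, substMatrix, Literal.vec_dotProduct]

/-- Compatible literals sum to at most the homogenizing coordinate on the cone of B: by an edge
constraint for two variables, with equality for x_a and 1 - x_a, and by the bounds if one literal is
0. -/
lemma substMatrix_mulVec_mem {G : SimpleGraph V} {B : SimpleGraph W} {L : V → Literal W}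
    (hL : ∀ u v, G.Adj u v → (L u).Compatible B (L v)) {z : Option W → ℝ}
    (hz : z ∈ homCone (edgeRelaxation B)) :
    (substMatrix L).mulVec z ∈ homCone (edgeRelaxation G) := by
  rw [mem_homCone_edgeRelaxation] at hz ⊢
  obtain ⟨h0, hb, he⟩ := hz
  have hb' : ∀ l : Literal W, 0 ≤ l.eval z ∧ l.eval z ≤ z none := by
    intro l
    cases l with
    | zero => exact ⟨le_rfl, h0⟩
    | pos a => exact hb a
    | neg a =>
      have := hb a
      simp only [Literal.eval]
      constructor <;> linarith
  simp only [substMatrix_mulVec, Option.elim]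
  refine ⟨h0, fun v => hb' (L v), fun u v huv => ?_⟩
  have h := hL u v huv
  revert h
  cases hu : L u <;> cases hv : L v <;> simp only [Literal.Compatible, Literal.eval] <;> intro h
  · simpa using h0
  · rename_i a; have := hb a; linarith
  · rename_i a; have := hb a; linarith
  · rename_i a; have := hb a; linarith
  · exact he _ _ h
  · subst h; linarith
  · rename_i a; have := hb a; linarith
  · subst h; linarith
  · exact h.elim

lemma mulVec_basisVec_apply (Y : Matrix (Option W) (Option W) ℝ) (a b : Option W) :
    Y.mulVec (basisVec a) b = Y b a := by
  simp [Matrix.mulVec, dotProduct_basisVec]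

variable [Fintype V] [DecidableEq V]

/-- Points of the Lovász–Schrijver relaxation can be pulled back along substitutions of literals. -/
theorem LSPlus_edgeRelaxation_subst [Nonempty W] {G : SimpleGraph V} {B : SimpleGraph W}
    {L : V → Literal W} (hL : ∀ u v, G.Adj u v → (L u).Compatible B (L v)) {x : W → ℝ}
    (hx : x ∈ LSPlus (edgeRelaxation B)) :
    (fun v => (L v).eval (homVec x)) ∈ LSPlus (edgeRelaxation G) := by
  obtain ⟨-, Y, ⟨⟨hsymm, hdiag, hcone⟩, hpsd⟩, hxY⟩ := hx
  have hcol0 : Y.mulVec (basisVec none) ∈ homCone (edgeRelaxation B) := by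
    obtain ⟨a⟩ := ‹Nonempty W›
    -- Y e₀ is the sum of Y e_a and Y (e₀ - e_a), for an arbitrary index a.
    have := homCone_edgeRelaxation_add (hcone a).1 (hcone a).2
    rwa [← Matrix.mulVec_add, add_sub_cancel] at this
  have hzero : (0 : Option W → ℝ) ∈ homCone (edgeRelaxation B) := by
    rw [mem_homCone_edgeRelaxation]
    simp
  have hlit : ∀ l : Literal W, Y.mulVec l.vec ∈ homCone (edgeRelaxation B) ∧
      Y.mulVec (basisVec none - l.vec) ∈ homCone (edgeRelaxation B) := by
    intro l
    cases l with
    | zero => simpa [Literal.vec] using ⟨hzero, hcol0⟩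
    | pos a => exact hcone a
    | neg a => simpa [Literal.vec] using (hcone a).symm
  have hmem := substMatrix_mulVec_mem hL hcol0
  have hd : ∀ a, Y a a = Y a none := fun a => by
    have := congrFun hdiag a
    rw [mulVec_basisVec_apply] at this
    exact this.symm
  have hs : ∀ a b, Y a b = Y b a := fun a b => by
    have := congrFun (congrFun hsymm b) a
    simpa using this
  set M := substMatrix L with hM
  have hMn : M.transpose.mulVec (basisVec none) = basisVec none := by
    funext o
    simp [Matrix.mulVec, dotProduct_basisVec, hM, substMatrix, Matrix.transpose_apply]
  have hMs : ∀ v, M.transpose.mulVec (basisVec (some v)) = (L v).vec := by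
    intro v
    funext o
    simp [Matrix.mulVec, dotProduct_basisVec, hM, substMatrix, Matrix.transpose_apply]
  have h00 : Y none none = 1 := by
    have := congrFun hxY none
    rw [mulVec_basisVec_apply] at this
    simpa [homVec] using this.symm
  -- The congruence by M preserves semidefiniteness, and its columns are images under M of Y applied
  -- to literal vectors.
  refine ⟨?_, M * Y * M.transpose, ⟨⟨?_, ?_, fun v => ?_⟩, ?_⟩, ?_⟩
  · have h := (mem_homCone_edgeRelaxation.1 hmem).2.1
    rw [hM, substMatrix_mulVec, ← hxY] at h
    simpa [homVec] using h
  · rw [Matrix.IsSymm, Matrix.transpose_mul, Matrix.transpose_mul, hsymm.eq,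
      Matrix.transpose_transpose, Matrix.mul_assoc]
  · rw [← Matrix.mulVec_mulVec, ← Matrix.mulVec_mulVec, hMn]
    funext o
    have hentry : (M * Y * M.transpose).diag o
        = (M.mulVec (Y.mulVec (M.transpose.mulVec (basisVec o)))) o := by
      rw [Matrix.mulVec_mulVec, Matrix.mulVec_mulVec, mulVec_basisVec_apply, Matrix.diag_apply]
    rw [hentry]
    cases o with
    | none => rw [hMn]
    | some v =>
      rw [hMs, hM, substMatrix_mulVec, substMatrix_mulVec]
      simp only [Option.elim]
      -- The diagonal condition encodes ℓ² = ℓ, which passes from x_a to 1 - x_a.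
      cases L v with
      | zero => rfl
      | pos a =>
        simp only [Literal.eval, Literal.vec, mulVec_basisVec_apply]
        exact (hd _).symm
      | neg a =>
        simp only [Literal.eval, Literal.vec, mulVec_basisVec_apply, Matrix.mulVec_sub,
          Pi.sub_apply]
        rw [hd (some a), hs none (some a)]
        ring
  · rw [← Matrix.mulVec_mulVec, ← Matrix.mulVec_mulVec, ← Matrix.mulVec_mulVec,
      ← Matrix.mulVec_mulVec, Matrix.mulVec_sub _ (basisVec none), hMn, hMs]
    exact ⟨substMatrix_mulVec_mem hL (hlit _).1, substMatrix_mulVec_mem hL (hlit _).2⟩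
  · have := hpsd.mul_mul_conjTranspose_same M
    rwa [Matrix.conjTranspose_eq_transpose_of_trivial] at this
  · rw [← Matrix.mulVec_mulVec, ← Matrix.mulVec_mulVec, hMn, hM, substMatrix_mulVec, ← hxY]
    funext o
    cases o <;> rfl

/-- A matrix criterion for membership in `LSPlus (edgeRelaxation G)`. -/
lemma mem_LSPlus_of_matrix {G : SimpleGraph V} (hiso : ∀ u, ∃ v, G.Adj u v)
    {Y : Matrix (Option V) (Option V) ℝ} (hpsd : Y.PosSemidef) (h00 : Y none none = 1)
    (hs : ∀ a b, Y a b = Y b a)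
    (hd : ∀ v, Y (some v) none = Y (some v) (some v))
    (hnn : ∀ u v, 0 ≤ Y (some u) (some v))
    (he : ∀ i u v, G.Adj u v → 0 ≤ Y (some i) (some i) - Y (some i) (some u) - Y (some i) (some v))
    (hc : ∀ i u v, G.Adj u v → 0 ≤ 1 - Y (some i) (some i) - Y (some u) (some u)
      - Y (some v) (some v) + Y (some i) (some u) + Y (some i) (some v)) :
    (fun v => Y (some v) (some v)) ∈ LSPlus (edgeRelaxation G) := by
  -- Since every node lies on an edge, the box constraints of the cone follow from the edge
  -- constraints.
  have hle : ∀ i u, Y (some i) (some u) ≤ Y (some i) (some i) := fun i u => by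
    obtain ⟨v, huv⟩ := hiso u
    linarith [he i u v huv, hnn i v]
  have hle' : ∀ i u, 0 ≤ 1 - Y (some i) (some i) - Y (some u) (some u) + Y (some i) (some u) :=
    fun i u => by
      obtain ⟨v, huv⟩ := hiso u
      have := hle v i
      rw [hs] at this
      linarith [hc i u v huv]
  have hone : ∀ v, Y (some v) (some v) ≤ 1 := fun v => by linarith [hle' v v]
  refine ⟨fun v => ⟨hnn v v, hone v⟩, Y, ⟨⟨?_, ?_, fun i => ⟨?_, ?_⟩⟩, hpsd⟩, ?_⟩
  · ext a b
    exact hs b a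
  · funext o
    rw [mulVec_basisVec_apply]
    cases o with
    | none => rfl
    | some v => exact hd v
  · rw [mem_homCone_edgeRelaxation]
    simp only [mulVec_basisVec_apply]
    rw [hs none, hd]
    refine ⟨hnn _ _, fun v => ⟨hnn _ _, ?_⟩, fun u v huv => ?_⟩
    · rw [hs]; exact hle i v
    · rw [hs (some u), hs (some v)]
      linarith [he i u v huv]
  · rw [mem_homCone_edgeRelaxation]
    simp only [Matrix.mulVec_sub, Pi.sub_apply, mulVec_basisVec_apply]
    rw [hs none (some i), hd, h00]
    refine ⟨by linarith [hone i], fun v => ⟨?_, ?_⟩, fun u v huv => ?_⟩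
    · rw [hd]; linarith [hle v i]
    · rw [hd, hs (some v) (some i)]; linarith [hle' i v]
    · rw [hd, hd, hs (some v) (some i), hs (some u) (some i)]
      linarith [hc i u v huv]
  · funext o
    rw [mulVec_basisVec_apply]
    cases o with
    | none => exact h00.symm
    | some v => exact (hd v).symm

end General

open Filter Topology

/-! ### Perturbing an average of tight stable sets -/

section Perturbation

/-- A nonnegative function on a compact set becomes positive where it vanishes after a small
perturbation that is positive there. -/
lemma IsCompact.exists_forall_nonneg_add_mul {E : Type*} [TopologicalSpace E] {K : Set E}
    (hK : IsCompact K) {f h : E → ℝ} (hf : Continuous f) (hh : Continuous h)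
    (hf0 : ∀ x ∈ K, 0 ≤ f x) (hpos : ∀ x ∈ K, f x = 0 → 0 < h x) :
    ∀ᶠ ε in 𝓝[>] (0 : ℝ), ∀ x ∈ K, 0 ≤ f x + ε * h x := by
  -- Only points with h ≤ 0 can cause trouble. On this compact set f has a positive minimum, which
  -- absorbs ε times the minimum of h.
  have hK' : IsCompact (K ∩ {x | h x ≤ 0}) :=
    hK.inter_right (isClosed_le hh continuous_const)
  rcases (K ∩ {x | h x ≤ 0}).eq_empty_or_nonempty with he | hne
  · filter_upwards [self_mem_nhdsWithin] with ε hε x hx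
    have : ¬ h x ≤ 0 := fun hx' => by
      have : x ∈ K ∩ {x | h x ≤ 0} := ⟨hx, hx'⟩
      rw [he] at this
      exact this
    exact add_nonneg (hf0 x hx) (mul_nonneg (le_of_lt hε) (not_le.1 this).le)
  · obtain ⟨x₀, hx₀, hmin⟩ := hK'.exists_isMinOn hne hf.continuousOn
    obtain ⟨x₁, hx₁, hmin'⟩ := hK'.exists_isMinOn hne hh.continuousOn
    have hm : 0 < f x₀ := by
      rcases (hf0 x₀ hx₀.1).eq_or_lt with h0 | h0
      · exact absurd (hpos x₀ hx₀.1 h0.symm) (not_lt.2 hx₀.2)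
      · exact h0
    have hlim : Tendsto (fun ε : ℝ => f x₀ + ε * h x₁) (𝓝[>] 0) (𝓝 (f x₀ + 0 * h x₁)) :=
      tendsto_nhdsWithin_of_tendsto_nhds ((continuous_const.add
        (continuous_id.mul continuous_const)).tendsto _)
    have hev := hlim.eventually (lt_mem_nhds (show 0 < f x₀ + 0 * h x₁ by linarith))
    filter_upwards [hev, self_mem_nhdsWithin] with ε h1 hε x hx
    have hε' : 0 < ε := hε
    by_cases hx' : h x ≤ 0
    · have h2 : f x₀ ≤ f x := hmin ⟨hx, hx'⟩
      have h3 : h x₁ ≤ h x := hmin' ⟨hx, hx'⟩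
      nlinarith
    · exact add_nonneg (hf0 x hx) (mul_nonneg hε'.le (not_le.1 hx').le)

lemma eventually_nonneg_add_mul {a b : ℝ} (ha : 0 ≤ a) (h : 0 ≤ b ∨ 0 < a) :
    ∀ᶠ ε in 𝓝[>] (0 : ℝ), 0 ≤ a + ε * b := by
  rcases h with h | h
  · filter_upwards [self_mem_nhdsWithin] with ε hε
    exact add_nonneg ha (mul_nonneg (le_of_lt hε) h)
  · have hlim : Tendsto (fun ε : ℝ => a + ε * b) (𝓝[>] 0) (𝓝 (a + 0 * b)) :=
      tendsto_nhdsWithin_of_tendsto_nhds ((continuous_const.add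
        (continuous_id.mul continuous_const)).tendsto _)
    filter_upwards [hlim.eventually (lt_mem_nhds (show 0 < a + 0 * b by linarith))] with ε hε
    exact hε.le

variable {W J : Type*} [Fintype W]

/-- The symmetric matrix of order `n + 1` with first row equal to the diagonal, and corner `0`. -/
def borderedMatrix (Z : W → W → ℝ) : Matrix (Option W) (Option W) ℝ
  | none, none => 0
  | none, some v => Z v v
  | some v, none => Z v v
  | some u, some v => Z u v

lemma dotProduct_borderedMatrix (Z : W → W → ℝ) (b : ℝ) (a : W → ℝ) (y : Option W → ℝ)
    (hn : y none = -b) (hs : ∀ v, y (some v) = a v) :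
    y ⬝ᵥ (borderedMatrix Z).mulVec y = ∑ u, ∑ v, a u * a v * Z u v - 2 * b * ∑ v, a v * Z v v := by
  simp only [dotProduct, Matrix.mulVec, Fintype.sum_option, borderedMatrix, hn, hs]
  simp only [mul_add, Finset.sum_add_distrib, Finset.mul_sum]
  have h1 : ∀ u v, a u * (Z u v * a v) = a u * a v * Z u v := fun u v => by ring
  simp only [h1]
  have h2 : ∑ i, -b * (Z i i * a i) + ∑ i, a i * (Z i i * -b) = - ∑ i, 2 * b * (a i * Z i i) := by
    rw [← Finset.sum_add_distrib, ← Finset.sum_neg_distrib]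
    exact Finset.sum_congr rfl fun i _ => by ring
  linarith

variable [DecidableEq W] [Fintype J] [Nonempty J]

/-- Let `a · x ≤ β` be an inequality that is tight at the stable sets `S j`, and determined by them
up to scaling. If the direction `Z` has a positive quadratic form at `(-β, a)`, increases `a · x`,
and satisfies those constraints of the Lovász–Schrijver operator that are tight at all `S j`, then
`LS₊` contains a point violating the inequality. -/
theorem exists_mem_LSPlus_lt {G : SimpleGraph W} (hiso : ∀ u, ∃ v, G.Adj u v)
    (S : J → Finset W) (hS : ∀ j u v, u ∈ S j → v ∈ S j → ¬ G.Adj u v)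
    (a : W → ℝ) (b : ℝ) (htight : ∀ j, ∑ v ∈ S j, a v = b)
    (hker : ∀ y : Option W → ℝ, (∀ j, y none + ∑ v ∈ S j, y (some v) = 0) →
      ∃ c, y none = c * -b ∧ ∀ v, y (some v) = c * a v)
    (Z : W → W → ℝ) (hZ : ∀ u v, Z u v = Z v u)
    (h1 : ∀ u v, 0 ≤ Z u v ∨ ∃ j, u ∈ S j ∧ v ∈ S j)
    (h2 : ∀ i u v, G.Adj u v → 0 ≤ Z i i - Z i u - Z i v ∨ ∃ j, i ∈ S j ∧ u ∉ S j ∧ v ∉ S j)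
    (h3 : ∀ i u v, G.Adj u v → 0 ≤ - Z i i - Z u u - Z v v + Z i u + Z i v ∨
      ∃ j, i ∉ S j ∧ u ∉ S j ∧ v ∉ S j)
    (hpos : 0 < ∑ v, a v * Z v v)
    (hquad : 2 * b * ∑ v, a v * Z v v < ∑ u, ∑ v, a u * a v * Z u v) :
    ∃ x ∈ LSPlus (edgeRelaxation G), b < ∑ v, a v * x v := by
  classical
  set N : ℝ := (Fintype.card J : ℝ) with hN
  have hNpos : 0 < N := by
    rw [hN]; exact_mod_cast Fintype.card_pos
  let χ : J → W → ℝ := fun j v => if v ∈ S j then 1 else 0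
  have havg : ∀ (g : J → ℝ) (B : ℝ), (∀ j, 0 ≤ g j) → (0 ≤ B ∨ ∃ j, 0 < g j) →
      ∀ᶠ ε in 𝓝[>] (0 : ℝ), 0 ≤ N⁻¹ * ∑ j, g j + ε * B := by
    intro g B hg hB
    refine eventually_nonneg_add_mul
      (mul_nonneg (inv_nonneg.2 hNpos.le) (Finset.sum_nonneg fun j _ => hg j))
      (hB.imp id fun ⟨j, hj⟩ => mul_pos (inv_pos.2 hNpos) ?_)
    exact Finset.sum_pos' (fun j _ => hg j) ⟨j, Finset.mem_univ _, hj⟩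
  let h : J → Option W → ℝ := fun j => homVec (χ j)
  -- The average moment matrix of the tight sets; its quadratic form is a mean of squares.
  let A : Matrix (Option W) (Option W) ℝ := fun o o' => N⁻¹ * ∑ j, h j o * h j o'
  have hA : ∀ y, y ⬝ᵥ A.mulVec y = N⁻¹ * ∑ j, (y ⬝ᵥ h j) ^ 2 := by
    intro y
    simp only [A, dotProduct, Matrix.mulVec, pow_two, Finset.mul_sum,
      Finset.sum_mul]
    rw [Finset.sum_comm_cycle]
    refine Finset.sum_congr rfl fun _ _ => Finset.sum_congr rfl fun _ _ =>
      Finset.sum_congr rfl fun _ _ => by ring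
  have hdot : ∀ (y : Option W → ℝ) j, y ⬝ᵥ h j = y none + ∑ v ∈ S j, y (some v) := by
    intro y j
    simp [dotProduct, Fintype.sum_option, h, homVec, χ]
  let Y : ℝ → Matrix (Option W) (Option W) ℝ := fun ε => A + ε • borderedMatrix Z
  have hY : ∀ ε o o', Y ε o o' = N⁻¹ * ∑ j, h j o * h j o' + ε * borderedMatrix Z o o' :=
    fun _ _ _ => rfl
  have hYs : ∀ ε o o', Y ε o o' = Y ε o' o := by
    intro ε o o'
    have : borderedMatrix Z o o' = borderedMatrix Z o' o := by
      cases o <;> cases o' <;> simp [borderedMatrix]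
      exact hZ _ _
    rw [hY, hY, this]
    simp only [mul_comm]
  have hpsd : ∀ᶠ ε in 𝓝[>] (0 : ℝ), (Y ε).PosSemidef := by
    have hcont : ∀ B : Matrix (Option W) (Option W) ℝ,
        Continuous fun y : Option W → ℝ => y ⬝ᵥ B.mulVec y := fun B => by
      simp only [dotProduct, Matrix.mulVec]
      fun_prop
    -- The form of A vanishes only on multiples of (-b, a), where the form of Z is positive.
    -- Compactness of the unit sphere gives one ε for all directions.
    have hev := IsCompact.exists_forall_nonneg_add_mul
      (isCompact_sphere (0 : Option W → ℝ) 1) (hcont A) (hcont (borderedMatrix Z))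
      (fun y _ => by
        rw [hA]
        exact mul_nonneg (inv_nonneg.2 hNpos.le) (Finset.sum_nonneg fun j _ => sq_nonneg _))
      (fun y hy h0 => by
        rw [hA] at h0
        have h0' := (mul_eq_zero.1 h0).resolve_left (inv_ne_zero hNpos.ne')
        rw [Finset.sum_eq_zero_iff_of_nonneg fun j _ => sq_nonneg _] at h0'
        obtain ⟨c, hcn, hcs⟩ := hker y fun j => by
          rw [← hdot]
          exact pow_eq_zero_iff two_ne_zero |>.1 (h0' j (Finset.mem_univ _))
        have hc : c ≠ 0 := by
          rintro rfl
          have : y = 0 := by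
            funext o
            cases o with
            | none => simpa using hcn
            | some v => simpa using hcs v
          rw [this] at hy
          simp at hy
        rw [dotProduct_borderedMatrix Z (c * b) (fun v => c * a v) y (by rw [hcn]; ring) hcs]
        have e1 : ∑ u, ∑ v, c * a u * (c * a v) * Z u v
            = c ^ 2 * ∑ u, ∑ v, a u * a v * Z u v := by
          simp only [Finset.mul_sum]
          exact Finset.sum_congr rfl fun _ _ => Finset.sum_congr rfl fun _ _ => by ring
        have e2 : ∑ v, c * a v * Z v v = c * ∑ v, a v * Z v v := by
          simp only [Finset.mul_sum]
          exact Finset.sum_congr rfl fun _ _ => by ring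
        rw [e1, e2]
        have : 0 < c ^ 2 := by positivity
        nlinarith)
    filter_upwards [hev] with ε hε
    refine Matrix.PosSemidef.of_dotProduct_mulVec_nonneg (by ext o o'; simpa using hYs ε o' o) fun y => ?_
    have hq : ∀ y, y ⬝ᵥ (Y ε).mulVec y
        = y ⬝ᵥ A.mulVec y + ε * (y ⬝ᵥ (borderedMatrix Z).mulVec y) := by
      intro y
      simp [Y, Matrix.add_mulVec, dotProduct_add, Matrix.smul_mulVec, dotProduct_smul]
    rw [star_trivial]
    rcases eq_or_ne y 0 with rfl | hy
    · simp
    · have hn : 0 < ‖y‖ := norm_pos_iff.2 hy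
      have := hε (‖y‖⁻¹ • y) (by simp [norm_smul, hn.ne'])
      rw [← hq] at this
      simp only [Matrix.mulVec_smul, dotProduct_smul, smul_dotProduct, smul_eq_mul] at this
      have h' : 0 < ‖y‖⁻¹ := inv_pos.2 hn
      exact nonneg_of_mul_nonneg_right (nonneg_of_mul_nonneg_right this h') h'
  have hYe : ∀ ε u v, Y ε (some u) (some v) = N⁻¹ * ∑ j, χ j u * χ j v + ε * Z u v := by
    intro ε u v
    simp [hY, h, homVec, borderedMatrix]
  have hχ : ∀ j v, χ j v * χ j v = χ j v := by
    intro j v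
    by_cases hv : v ∈ S j <;> simp [χ, hv]
  have hYd : ∀ ε v, Y ε (some v) none = Y ε (some v) (some v) := by
    intro ε v
    rw [hYe, hY]
    simp [h, homVec, borderedMatrix, hχ]
  have h00 : ∀ ε, Y ε none none = 1 := by
    intro ε
    simp only [hY, h, homVec, borderedMatrix, mul_one, mul_zero, add_zero, Finset.sum_const,
      Finset.card_univ, nsmul_eq_mul]
    exact inv_mul_cancel₀ hNpos.ne'
  have ev1 : ∀ᶠ ε in 𝓝[>] (0 : ℝ), ∀ u v, 0 ≤ Y ε (some u) (some v) := by
    simp only [eventually_all, hYe]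
    intro u v
    refine havg _ _ (fun j => ?_) ((h1 u v).imp id ?_)
    · by_cases hu : u ∈ S j <;> by_cases hv : v ∈ S j <;> simp [χ, hu, hv]
    · rintro ⟨j, hu, hv⟩
      exact ⟨j, by simp [χ, hu, hv]⟩
  have ev2 : ∀ᶠ ε in 𝓝[>] (0 : ℝ), ∀ i u v, G.Adj u v →
      0 ≤ Y ε (some i) (some i) - Y ε (some i) (some u) - Y ε (some i) (some v) := by
    simp only [eventually_all, hYe]
    intro i u v huv
    -- Over the tight sets, the constraint is the mean of these products. Each is nonnegative, and
    -- it is positive when the set contains i and misses u and v.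
    have := havg (fun j => χ j i * (1 - χ j u - χ j v)) (Z i i - Z i u - Z i v) (fun j => ?_)
      ((h2 i u v huv).imp id ?_)
    · filter_upwards [this] with ε hε
      refine hε.trans_eq ?_
      simp only [mul_sub, Finset.sum_sub_distrib, mul_one, hχ]
      ring
    · have := hS j u v
      by_cases hi : i ∈ S j <;> by_cases hu : u ∈ S j <;> by_cases hv : v ∈ S j <;>
        simp [χ, hi, hu, hv]
      exact (this hu hv huv).elim
    · rintro ⟨j, hi, hu, hv⟩
      exact ⟨j, by simp [χ, hi, hu, hv]⟩
  have ev3 : ∀ᶠ ε in 𝓝[>] (0 : ℝ), ∀ i u v, G.Adj u v →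
      0 ≤ 1 - Y ε (some i) (some i) - Y ε (some u) (some u)
      - Y ε (some v) (some v) + Y ε (some i) (some u) + Y ε (some i) (some v) := by
    simp only [eventually_all, hYe]
    intro i u v huv
    have := havg (fun j => (1 - χ j i) * (1 - χ j u - χ j v))
      (- Z i i - Z u u - Z v v + Z i u + Z i v) (fun j => ?_) ((h3 i u v huv).imp id ?_)
    · filter_upwards [this] with ε hε
      refine hε.trans_eq ?_
      have hone : N⁻¹ * ∑ _j : J, (1 : ℝ) = 1 := by
        simp only [Finset.sum_const, Finset.card_univ, nsmul_eq_mul, mul_one]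
        exact inv_mul_cancel₀ hNpos.ne'
      simp only [mul_sub, sub_mul, Finset.sum_sub_distrib, mul_one, hχ, hone, one_mul]
      ring
    · have := hS j u v
      by_cases hi : i ∈ S j <;> by_cases hu : u ∈ S j <;> by_cases hv : v ∈ S j <;>
        simp [χ, hi, hu, hv]
      exact (this hu hv huv).elim
    · rintro ⟨j, hi, hu, hv⟩
      exact ⟨j, by simp [χ, hi, hu, hv]⟩
  obtain ⟨ε, hpsd, ev1, ev2, ev3, hε⟩ :=
    (hpsd.and (ev1.and (ev2.and (ev3.and self_mem_nhdsWithin)))).exists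
  refine ⟨_, mem_LSPlus_of_matrix hiso hpsd (h00 ε) (hYs ε) (hYd ε) ev1 ev2 ev3, ?_⟩
  have hsum : ∑ v, a v * Y ε (some v) (some v) = b + ε * ∑ v, a v * Z v v := by
    simp only [hYe, hχ, mul_add, Finset.sum_add_distrib]
    congr 1
    · simp only [Finset.mul_sum]
      rw [Finset.sum_comm]
      have : ∀ j, ∑ v, a v * (N⁻¹ * χ j v) = N⁻¹ * b := by
        intro j
        rw [← htight j, Finset.mul_sum, ← Finset.sum_subset (Finset.subset_univ (S j))]
        · exact Finset.sum_congr rfl fun v hv => by simp [χ, hv, mul_comm]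
        · intro v _ hv
          simp [χ, hv]
      simp only [this, Finset.sum_const, Finset.card_univ, nsmul_eq_mul]
      rw [← hN, ← mul_assoc, mul_inv_cancel₀ hNpos.ne', one_mul]
    · rw [Finset.mul_sum]
      exact Finset.sum_congr rfl fun _ _ => by ring
  rw [hsum]
  have : 0 < ε := hε
  have := mul_pos this hpos
  linarith

end Perturbation

/-! ### The rim of the wheel: maximum stable sets and the direction -/

section Wheel

/-- Adjacency in the cycle `0, 1, …, 2k`. -/
def CycAdj (k i j : ℕ) : Prop :=
  i ≠ j ∧ (i + 1 = j ∨ j + 1 = i ∨ (i = 0 ∧ j = 2 * k) ∨ (i = 2 * k ∧ j = 0))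

instance (k i j : ℕ) : Decidable (CycAdj k i j) := by
  unfold CycAdj; infer_instance

lemma CycAdj.symm {k i j : ℕ} (h : CycAdj k i j) : CycAdj k j i := by
  unfold CycAdj at *; omega

/-- The wheel with the odd cycle `0, 1, …, 2k` as its rim, without the spoke at `0`. -/
def wheelMinusSpoke (k : ℕ) : SimpleGraph (Option (Fin (2 * k + 1))) where
  Adj
    | none, none => False
    | none, some i => (i : ℕ) ≠ 0
    | some i, none => (i : ℕ) ≠ 0
    | some i, some j => CycAdj k i j
  symm := ⟨by
    rintro (_ | i) (_ | j) h
    · exact h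
    · exact h
    · exact h
    · exact CycAdj.symm h⟩
  loopless := ⟨by
    rintro (_ | i) h
    · exact h
    · exact h.1 rfl⟩

/-- `i` lies in the maximum stable set `j + 1, j + 3, …, j - 2` of the cycle `0, 1, …, 2k`. -/
def MaxStable (j i : ℕ) : Prop := (j < i ∧ (i - j) % 2 = 1) ∨ (i < j ∧ (j - i) % 2 = 0)

instance (j i : ℕ) : Decidable (MaxStable j i) := by
  unfold MaxStable; infer_instance

/-- Counting the members below an arbitrary m makes the size of the set accessible to induction. -/
lemma sum_ite_maxStable_one (j m : ℕ) : ∑ i ∈ Finset.range m, (if MaxStable j i then 1 else 0)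
    = if m ≤ j then (m + (j + 1) % 2) / 2 else j / 2 + (m - j) / 2 := by
  induction m with
  | zero =>
    rw [Finset.range_zero, Finset.sum_empty, if_pos (Nat.zero_le _)]
    omega
  | succ m ih =>
    rw [Finset.sum_range_succ, ih]
    split_ifs <;> simp only [MaxStable] at * <;> omega

lemma sum_ite_maxStable {k j : ℕ} (hj : j ≤ 2 * k) (c : ℝ) :
    ∑ i ∈ Finset.range (2 * k + 1), (if MaxStable j i then c else 0) = k * c := by
  have h := sum_ite_maxStable_one j (2 * k + 1)
  rw [if_neg (by omega), show j / 2 + (2 * k + 1 - j) / 2 = k by omega] at h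
  have h' : (∑ i ∈ Finset.range (2 * k + 1), if MaxStable j i then (1 : ℝ) else 0) = k := by
    exact_mod_cast h
  rw [← h', Finset.sum_mul]
  exact Finset.sum_congr rfl fun i _ => by split_ifs <;> simp

lemma eq_of_sum_ite_exchange {n p q : ℕ} (hp : p < n) (hq : q < n) {P Q : ℕ → Prop}
    [DecidablePred P] [DecidablePred Q] (h : ∀ i < n, Q i ↔ (P i ∧ i ≠ p) ∨ i = q) (hPp : P p)
    (hPq : ¬ P q) (f : ℕ → ℝ)
    (hsum : ∑ i ∈ Finset.range n, (if P i then f i else 0)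
      = ∑ i ∈ Finset.range n, (if Q i then f i else 0)) : f p = f q := by
  have : ∀ i ∈ Finset.range n, (if Q i then f i else 0)
      = (if P i then f i else 0) - (if p = i then f i else 0) + (if q = i then f i else 0) := by
    intro i hi
    have hi' := h i (Finset.mem_range.1 hi)
    rcases eq_or_ne i q with rfl | hiq
    · have : p ≠ i := by rintro rfl; exact hPq hPp
      simp [hi', this, hPq]
    · rcases eq_or_ne i p with rfl | hip
      · simp [hi', hPp, hiq, hiq.symm]
      · simp [hi', hiq, hip, hiq.symm, hip.symm]
  rw [Finset.sum_congr rfl this, Finset.sum_add_distrib, Finset.sum_sub_distrib,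
    Finset.sum_ite_eq, Finset.sum_ite_eq, if_pos (Finset.mem_range.2 hp),
    if_pos (Finset.mem_range.2 hq)] at hsum
  linarith

/-- The stable sets with index i and i + 2 differ only in that i + 1 is exchanged for i, so equal
sums force equal values at these neighbours. -/
lemma const_of_sum_maxStable {k : ℕ} (hk : 1 ≤ k) (f : ℕ → ℝ) (b : ℝ)
    (h : ∀ j ≤ 2 * k, ∑ i ∈ Finset.range (2 * k + 1), (if MaxStable j i then f i else 0) = b) :
    ∀ i ≤ 2 * k, f i = f 0 := by
  have step : ∀ i, i + 1 ≤ 2 * k → f (i + 1) = f i := by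
    intro i hi
    rcases Nat.lt_or_ge (i + 1) (2 * k) with hlt | hge
    · refine eq_of_sum_ite_exchange (n := 2 * k + 1) (P := MaxStable i) (Q := MaxStable (i + 2))
        (by omega) (by omega) (fun l hl => ?_) ?_ ?_ f ((h _ (by omega)).trans (h _ (by omega)).symm)
      all_goals unfold MaxStable; omega
    -- Here i = 2k - 1, and the index i + 2 wraps around to 0.
    · refine eq_of_sum_ite_exchange (n := 2 * k + 1) (P := MaxStable i) (Q := MaxStable 0)
        (by omega) (by omega) (fun l hl => ?_) ?_ ?_ f ((h _ (by omega)).trans (h _ (by omega)).symm)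
      all_goals unfold MaxStable; omega
  intro i
  induction i with
  | zero => intro; rfl
  | succ i ih => intro hi; rw [step i hi, ih (by omega)]

/-- The perturbation for the wheel, on the rim. -/
def wheelDir (k i l : ℕ) : ℤ :=
  if i = 0 ∧ l = 0 then 1 else if i = l ∨ CycAdj k i l then 0 else if i = 0 ∨ l = 0 then 2 else
    if (i + l) % 2 = 0 then -2 else 2

lemma wheelDir_spec (k i l : ℕ) : (wheelDir k i l = 1 ∧ i = 0 ∧ l = 0) ∨
    (wheelDir k i l = 0 ∧ (i = l ∧ i ≠ 0 ∨ i ≠ l ∧ (i + 1 = l ∨ l + 1 = i ∨ (i = 0 ∧ l = 2 * k) ∨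
      (i = 2 * k ∧ l = 0)))) ∨
    (wheelDir k i l = 2 ∧ i ≠ l ∧ i + 1 ≠ l ∧ l + 1 ≠ i ∧ (i = 0 ∧ l ≠ 2 * k ∨ l = 0 ∧ i ≠ 2 * k ∨
      i ≠ 0 ∧ l ≠ 0 ∧ (i + l) % 2 = 1)) ∨
    (wheelDir k i l = -2 ∧ i ≠ l ∧ i ≠ 0 ∧ l ≠ 0 ∧ (i + l) % 2 = 0) := by
  unfold wheelDir CycAdj
  split_ifs <;> omega

lemma wheelDir_self (k i : ℕ) : wheelDir k i i = if i = 0 then 1 else 0 := by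
  unfold wheelDir
  split_ifs <;> omega

lemma wheelDir_of_cycAdj {k i l : ℕ} (h : CycAdj k i l) : wheelDir k i l = 0 := by
  have := h.1
  rw [wheelDir, if_neg (by omega), if_pos (Or.inr h)]

lemma wheelDir_comm (k i l : ℕ) : wheelDir k i l = wheelDir k l i := by
  rcases wheelDir_spec k i l with h | h | h | h <;>
    rcases wheelDir_spec k l i with h' | h' | h' | h' <;> omega

lemma sum_parity (k i : ℕ) : ∑ l ∈ Finset.range (2 * k + 1), (if (i + l) % 2 = 0 then -2 else 2)
    = if i % 2 = 0 then (-2 : ℤ) else 2 := by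
  induction k with
  | zero => simp
  | succ k ih =>
    rw [show 2 * (k + 1) + 1 = 2 * k + 1 + 1 + 1 by ring, Finset.sum_range_succ,
      Finset.sum_range_succ, ih]
    split_ifs <;> omega

lemma sum_wheelDir_zero {k : ℕ} (hk : 2 ≤ k) :
    ∑ l ∈ Finset.range (2 * k + 1), wheelDir k 0 l = 4 * k - 3 := by
  have : ∀ l ∈ Finset.range (2 * k + 1), wheelDir k 0 l = 2 - (if 0 = l then 1 else 0)
      - (if 1 = l then 2 else 0) - (if 2 * k = l then 2 else 0) := by
    intro l hl
    rw [Finset.mem_range] at hl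
    rcases wheelDir_spec k 0 l with h | h | h | h <;> split_ifs <;> omega
  rw [Finset.sum_congr rfl this]
  simp only [Finset.sum_sub_distrib, Finset.sum_ite_eq, Finset.mem_range, Finset.sum_const,
    Finset.card_range]
  rw [if_pos (by omega), if_pos (by omega), if_pos (by omega)]
  ring

/-- Row i differs from the alternating row of `sum_parity` only at i, its neighbours and 0, and
these corrections cancel the alternating sum. -/
lemma sum_wheelDir_of_pos {k i : ℕ} (hk : 2 ≤ k) (hi : 1 ≤ i) (hi' : i ≤ 2 * k) :
    ∑ l ∈ Finset.range (2 * k + 1), wheelDir k i l = 0 := by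
  have : ∀ l ∈ Finset.range (2 * k + 1), wheelDir k i l = (if (i + l) % 2 = 0 then -2 else 2)
      + (if i = l then 2 else 0) - (if i + 1 = l then 2 else 0) - (if i - 1 = l then 2 else 0)
      + (if 0 = l then (if i = 2 * k then 2 else if i % 2 = 0 then 4 else 0) else 0) := by
    intro l hl
    rw [Finset.mem_range] at hl
    rcases wheelDir_spec k i l with h | h | h | h <;> split_ifs <;> omega
  rw [Finset.sum_congr rfl this]
  simp only [Finset.sum_sub_distrib, Finset.sum_add_distrib, Finset.sum_ite_eq, Finset.mem_range,
    sum_parity]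
  split_ifs <;> omega

/-- Negative entries occur only at distinct nonzero nodes u < v of equal parity, and the stable set
with index u - 1 contains both. -/
lemma wheelDir_nonneg_or {k u v : ℕ} (hu : u ≤ 2 * k) (hv : v ≤ 2 * k) :
    0 ≤ wheelDir k u v ∨ ∃ j ≤ 2 * k, MaxStable j u ∧ MaxStable j v := by
  wlog huv : u ≤ v generalizing u v
  · have := this hv hu (by omega)
    rw [wheelDir_comm]
    exact this.imp id fun ⟨j, hj, h1, h2⟩ => ⟨j, hj, h2, h1⟩
  by_cases hp : (v - u) % 2 = 0
  · rcases Nat.eq_zero_or_pos u with rfl | h0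
    · left
      unfold wheelDir
      split_ifs <;> omega
    · rcases eq_or_ne u v with rfl | hne
      · left
        unfold wheelDir
        split_ifs <;> omega
      · right
        refine ⟨u - 1, by omega, ?_, ?_⟩ <;> unfold MaxStable <;> omega
  · left
    unfold wheelDir
    split_ifs <;> omega

/-- The sets i, i + 2, …, i - 3 and i + 3, i + 5, …, i (indices i - 1 and i + 2) meet only in i, so
one of them misses u. -/
lemma exists_maxStable_mem_notMem {k i u : ℕ} (hk : 2 ≤ k) (hi : i ≤ 2 * k) (hu : u ≤ 2 * k)
    (hne : i ≠ u) : ∃ j ≤ 2 * k, MaxStable j i ∧ ¬ MaxStable j u := by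
  by_cases h : MaxStable (if i = 0 then 2 * k else i - 1) u
  · refine ⟨if i + 2 ≤ 2 * k then i + 2 else i + 1 - 2 * k, by split_ifs <;> omega, ?_, ?_⟩ <;>
      revert h <;> unfold MaxStable <;> split_ifs <;> omega
  · refine ⟨if i = 0 then 2 * k else i - 1, by split_ifs <;> omega, ?_, h⟩
    unfold MaxStable
    split_ifs <;> omega

/-- Each set misses its own index, and the sets with indices i and u cannot contain each other's
index simultaneously, as the two cyclic distances between i and u have opposite parity. -/
lemma exists_maxStable_notMem_notMem {k i u : ℕ} (hi : i ≤ 2 * k) (hu : u ≤ 2 * k) :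
    ∃ j ≤ 2 * k, ¬ MaxStable j i ∧ ¬ MaxStable j u := by
  by_cases h : MaxStable i u
  · refine ⟨u, hu, ?_, ?_⟩ <;> revert h <;> unfold MaxStable <;> omega
  · exact ⟨i, hi, by unfold MaxStable; omega, h⟩

/-- For v the successor of u, the set with index v misses both, so entries matter only if i lies
outside it. The last alternative is the case where {hub, 0} gives slack. -/
lemma wheelDir_column {k i u v : ℕ} (hk : 2 ≤ k) (hi : i ≤ 2 * k) (hu : u ≤ 2 * k)
    (hv : v ≤ 2 * k) (huv : CycAdj k u v) : 0 ≤ wheelDir k i i - wheelDir k i u - wheelDir k i v ∨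
      (∃ j ≤ 2 * k, MaxStable j i ∧ ¬ MaxStable j u ∧ ¬ MaxStable j v) ∨
      (i = 0 ∧ u ≠ 0 ∧ v ≠ 0) := by
  wlog h : u + 1 = v ∨ (u = 2 * k ∧ v = 0) generalizing u v
  · have := this hv hu huv.symm (by unfold CycAdj at huv; omega)
    rw [sub_right_comm]
    refine this.imp id (Or.imp ?_ ?_)
    · rintro ⟨j, hj, h1, h2, h3⟩
      exact ⟨j, hj, h1, h3, h2⟩
    · tauto
  by_cases hS : MaxStable v i
  · refine Or.inr (Or.inl ⟨v, hv, hS, ?_, ?_⟩) <;> unfold MaxStable <;> omega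
  · by_cases h0 : i = 0 ∧ u ≠ 0 ∧ v ≠ 0
    · exact Or.inr (Or.inr h0)
    · left
      rcases eq_or_ne i u with rfl | hiu
      · rw [wheelDir_of_cycAdj huv]
        omega
      rcases eq_or_ne i v with rfl | hiv
      · rw [wheelDir_of_cycAdj huv.symm]
        omega
      unfold MaxStable at hS
      rw [wheelDir_self, if_neg (by omega)]
      rcases wheelDir_spec k i u with h1 | h1 | h1 | h1 <;>
        rcases wheelDir_spec k i v with h2 | h2 | h2 | h2 <;> omega

/-- As for columns, now with i inside the set with index v as the critical case. If all three nodes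
are nonzero, {hub, 0} misses them. -/
lemma wheelDir_complement {k i u v : ℕ} (hk : 2 ≤ k) (hi : i ≤ 2 * k) (hu : u ≤ 2 * k)
    (hv : v ≤ 2 * k) (huv : CycAdj k u v) :
    0 ≤ - wheelDir k i i - wheelDir k u u - wheelDir k v v + wheelDir k i u + wheelDir k i v ∨
      (∃ j ≤ 2 * k, ¬ MaxStable j i ∧ ¬ MaxStable j u ∧ ¬ MaxStable j v) ∨
      (i ≠ 0 ∧ u ≠ 0 ∧ v ≠ 0) := by
  wlog h : u + 1 = v ∨ (u = 2 * k ∧ v = 0) generalizing u v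
  · have := this hv hu huv.symm (by unfold CycAdj at huv; omega)
    rw [add_right_comm, sub_right_comm _ (wheelDir k u u)]
    refine this.imp id (Or.imp ?_ ?_)
    · rintro ⟨j, hj, h1, h2, h3⟩
      exact ⟨j, hj, h1, h3, h2⟩
    · tauto
  by_cases hS : ¬ MaxStable v i
  · refine Or.inr (Or.inl ⟨v, hv, hS, ?_, ?_⟩) <;> unfold MaxStable <;> omega
  · by_cases h0 : i ≠ 0 ∧ u ≠ 0 ∧ v ≠ 0
    · exact Or.inr (Or.inr h0)
    · left
      unfold MaxStable at hS
      rw [wheelDir_self, wheelDir_self, wheelDir_self]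
      rcases Nat.eq_zero_or_pos i with rfl | hi0
      · rw [if_pos rfl, if_neg (by omega), if_neg (by omega)]
        rcases wheelDir_spec k 0 u with h1 | h1 | h1 | h1 <;>
          rcases wheelDir_spec k 0 v with h2 | h2 | h2 | h2 <;> omega
      · rw [if_neg (by omega)]
        rcases wheelDir_spec k i u with h1 | h1 | h1 | h1 <;>
          rcases wheelDir_spec k i v with h2 | h2 | h2 | h2 <;> split_ifs <;> omega

end Wheel

/-! ### Adding the hub; the violating point for the wheel minus a spoke -/

section Hub

/-- The sets `{i | M j i}` of rim nodes, and the set formed by the hub and node `0` of the rim. -/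
def hubFamily (k : ℕ) (M : ℕ → ℕ → Prop) [DecidableRel M] (j : Option (Fin (2 * k + 1))) :
    Finset (Option (Fin (2 * k + 1))) :=
  match j with
  | none => {none, some 0}
  | some j => (Finset.univ.filter fun i : Fin (2 * k + 1) => M j i).map .some

variable {k : ℕ} {M : ℕ → ℕ → Prop} [DecidableRel M]

lemma mem_hubFamily_none {v : Option (Fin (2 * k + 1))} :
    v ∈ hubFamily k M none ↔ v = none ∨ v = some 0 := by
  simp [hubFamily]

lemma some_mem_hubFamily {i j : Fin (2 * k + 1)} :
    some i ∈ hubFamily k M (some j) ↔ M j i := by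
  simp [hubFamily]

lemma none_notMem_hubFamily {j : Fin (2 * k + 1)} :
    none ∉ hubFamily k M (some j) := by
  simp [hubFamily]

lemma sum_hubFamily_none (g : Option (Fin (2 * k + 1)) → ℝ) :
    ∑ v ∈ hubFamily k M none, g v = g none + g (some 0) := by
  rw [hubFamily, Finset.sum_pair (by simp)]

lemma sum_hubFamily_some (j : Fin (2 * k + 1)) (g : Option (Fin (2 * k + 1)) → ℝ)
    (f : ℕ → ℝ) (hf : ∀ i : Fin (2 * k + 1), f i = g (some i)) :
    ∑ v ∈ hubFamily k M (some j), g v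
      = ∑ i ∈ Finset.range (2 * k + 1), if M j i then f i else 0 := by
  rw [hubFamily, Finset.sum_map, Finset.sum_filter, Finset.sum_range]
  exact Finset.sum_congr rfl fun i _ => by simp [hf]

/-- A perturbation of the rim, extended by `0` to the hub. -/
def hubDir (k : ℕ) (D : ℕ → ℕ → ℤ) : Option (Fin (2 * k + 1)) → Option (Fin (2 * k + 1)) → ℤ
  | some i, some l => D i l
  | _, _ => 0

lemma exists_fin_of_exists_nat {p : ℕ → Prop} (h : ∃ j ≤ 2 * k, p j) :
    ∃ j : Fin (2 * k + 1), p j := by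
  obtain ⟨j, hj, hp⟩ := h
  exact ⟨⟨j, by omega⟩, hp⟩

lemma fin_val_eq_zero_iff {i : Fin (2 * k + 1)} : i = 0 ↔ (i : ℕ) = 0 := by
  rw [Fin.ext_iff]; rfl

lemma wheel_nonneg_or (u v : Option (Fin (2 * k + 1))) :
    0 ≤ hubDir k (wheelDir k) u v ∨ ∃ j, u ∈ hubFamily k MaxStable j ∧ v ∈ hubFamily k MaxStable j := by
  match u, v with
  | none, _ => exact Or.inl le_rfl
  | some _, none => exact Or.inl le_rfl
  | some u, some v =>
    refine (wheelDir_nonneg_or (k := k) (by omega : (u : ℕ) ≤ 2 * k)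
      (by omega : (v : ℕ) ≤ 2 * k)).imp id fun h => ?_
    obtain ⟨j, h1, h2⟩ := exists_fin_of_exists_nat h
    exact ⟨some j, some_mem_hubFamily.2 h1, some_mem_hubFamily.2 h2⟩

lemma wheel_column (hk : 2 ≤ k) (i u v : Option (Fin (2 * k + 1)))
    (huv : (wheelMinusSpoke k).Adj u v) :
    0 ≤ hubDir k (wheelDir k) i i - hubDir k (wheelDir k) i u - hubDir k (wheelDir k) i v ∨
      ∃ j, i ∈ hubFamily k MaxStable j ∧ u ∉ hubFamily k MaxStable j ∧ v ∉ hubFamily k MaxStable j := by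
  have key : ∀ i u : Fin (2 * k + 1), 0 ≤ wheelDir k i i - wheelDir k i u ∨
      ∃ j, some i ∈ hubFamily k MaxStable j ∧ some u ∉ hubFamily k MaxStable j ∧ none ∉ hubFamily k MaxStable j := by
    intro i u
    rcases eq_or_ne i u with rfl | h
    · left; omega
    · right
      obtain ⟨j, h1, h2⟩ := exists_fin_of_exists_nat (exists_maxStable_mem_notMem hk
        (by omega : (i : ℕ) ≤ 2 * k) (by omega : (u : ℕ) ≤ 2 * k) (by omega))
      exact ⟨some j, some_mem_hubFamily.2 h1, mt some_mem_hubFamily.1 h2,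
        none_notMem_hubFamily⟩
  match i, u, v, huv with
  | none, _, _, _ => exact Or.inl le_rfl
  | some i, none, some v, _ =>
    refine (key i v).imp (fun h => ?_) ?_
    · simpa [hubDir] using h
    · rintro ⟨j, h1, h2, h3⟩
      exact ⟨j, h1, h3, h2⟩
  | some i, some u, none, _ =>
    refine (key i u).imp (fun h => ?_) id
    simpa [hubDir] using h
  | some i, some u, some v, huv =>
    rcases wheelDir_column hk (by omega : (i : ℕ) ≤ 2 * k) (by omega) (by omega) huv
      with h | h | ⟨h1, h2, h3⟩
    · exact Or.inl h
    · right
      obtain ⟨j, h1, h2, h3⟩ := exists_fin_of_exists_nat h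
      exact ⟨some j, some_mem_hubFamily.2 h1, mt some_mem_hubFamily.1 h2,
        mt some_mem_hubFamily.1 h3⟩
    · right
      refine ⟨none, ?_, ?_, ?_⟩ <;> simp [mem_hubFamily_none, fin_val_eq_zero_iff, h1, h2, h3]

lemma wheel_complement (hk : 2 ≤ k) (i u v : Option (Fin (2 * k + 1)))
    (huv : (wheelMinusSpoke k).Adj u v) :
    0 ≤ - hubDir k (wheelDir k) i i - hubDir k (wheelDir k) u u - hubDir k (wheelDir k) v v
        + hubDir k (wheelDir k) i u + hubDir k (wheelDir k) i v ∨
      ∃ j, i ∉ hubFamily k MaxStable j ∧ u ∉ hubFamily k MaxStable j ∧ v ∉ hubFamily k MaxStable j := by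
  have key : ∀ i u : Fin (2 * k + 1), ∃ j, some i ∉ hubFamily k MaxStable (some j) ∧
      some u ∉ hubFamily k MaxStable (some j) := by
    intro i u
    obtain ⟨j, h1, h2⟩ := exists_fin_of_exists_nat (exists_maxStable_notMem_notMem
        (by omega : (i : ℕ) ≤ 2 * k) (by omega : (u : ℕ) ≤ 2 * k))
    exact ⟨j, mt some_mem_hubFamily.1 h1, mt some_mem_hubFamily.1 h2⟩
  match i, u, v, huv with
  | none, none, some v, _ =>
    obtain ⟨j, h1, h2⟩ := key v v
    exact Or.inr ⟨_, none_notMem_hubFamily, none_notMem_hubFamily, h1⟩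
  | none, some u, none, _ =>
    obtain ⟨j, h1, h2⟩ := key u u
    exact Or.inr ⟨_, none_notMem_hubFamily, h1, none_notMem_hubFamily⟩
  | none, some u, some v, _ =>
    obtain ⟨j, h1, h2⟩ := key u v
    exact Or.inr ⟨_, none_notMem_hubFamily, h1, h2⟩
  | some i, none, some v, _ =>
    obtain ⟨j, h1, h2⟩ := key i v
    exact Or.inr ⟨_, h1, none_notMem_hubFamily, h2⟩
  | some i, some u, none, _ =>
    obtain ⟨j, h1, h2⟩ := key i u
    exact Or.inr ⟨_, h1, h2, none_notMem_hubFamily⟩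
  | some i, some u, some v, huv =>
    rcases wheelDir_complement hk (by omega : (i : ℕ) ≤ 2 * k) (by omega) (by omega) huv
      with h | h | ⟨h1, h2, h3⟩
    · exact Or.inl h
    · right
      obtain ⟨j, h1, h2, h3⟩ := exists_fin_of_exists_nat h
      exact ⟨some j, mt some_mem_hubFamily.1 h1, mt some_mem_hubFamily.1 h2,
        mt some_mem_hubFamily.1 h3⟩
    · right
      refine ⟨none, ?_, ?_, ?_⟩ <;> simp [mem_hubFamily_none, fin_val_eq_zero_iff, h1, h2, h3]

/-- For the wheel without one spoke, `LS₊` violates a facet of the stable set polytope. -/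
theorem exists_mem_LSPlus_wheelMinusSpoke (hk : 2 ≤ k) :
    ∃ x ∈ LSPlus (edgeRelaxation (wheelMinusSpoke k)),
      (k : ℝ) < ∑ i, x (some i) + (k - 1) * x none := by
  suffices h : ∃ x ∈ LSPlus (edgeRelaxation (wheelMinusSpoke k)),
      (k : ℝ) < ∑ v, (Option.elim v ((k : ℝ) - 1) fun _ => 1) * x v by
    obtain ⟨x, hx, hlt⟩ := h
    refine ⟨x, hx, hlt.trans_eq ?_⟩
    rw [Fintype.sum_option]
    simp [add_comm]
  refine exists_mem_LSPlus_lt (G := wheelMinusSpoke k) ?_ (hubFamily k MaxStable) ?_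
    (fun v => v.elim ((k : ℝ) - 1) fun _ => 1) k ?_ ?_
    (fun u v => (hubDir k (wheelDir k) u v : ℝ)) ?_
    (fun u v => by exact_mod_cast wheel_nonneg_or u v)
    (fun i u v huv => by exact_mod_cast wheel_column hk i u v huv)
    (fun i u v huv => by exact_mod_cast wheel_complement hk i u v huv) ?_ ?_
  · rintro (_ | i)
    · exact ⟨some ⟨1, by omega⟩, by simp [wheelMinusSpoke]⟩
    · refine ⟨some ⟨if (i : ℕ) = 0 then 1 else i - 1, by split_ifs <;> omega⟩, ?_⟩
      simp only [wheelMinusSpoke, CycAdj]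
      split_ifs <;> omega
  · rintro (_ | j) (_ | u) (_ | v) hu hv huv
    all_goals simp only [wheelMinusSpoke, CycAdj, mem_hubFamily_none, some_mem_hubFamily,
      none_notMem_hubFamily, MaxStable, Option.some.injEq, fin_val_eq_zero_iff, reduceCtorEq,
      false_or] at hu hv huv
    all_goals omega
  · rintro (_ | j)
    · rw [sum_hubFamily_none]
      simp
    · rw [sum_hubFamily_some j _ (fun _ => 1) (fun _ => rfl),
        sum_ite_maxStable (by omega), mul_one]
  -- The rim sets make y constant on the rim and fix its leading entry; the set {hub, 0} then
  -- determines the hub entry.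
  · intro y hy
    let f : ℕ → ℝ := fun i => if h : i < 2 * k + 1 then y (some (some ⟨i, h⟩)) else 0
    have hf : ∀ i : Fin (2 * k + 1), f i = y (some (some i)) := fun i => dif_pos i.isLt
    have hc : ∀ i ≤ 2 * k, f i = f 0 := by
      refine const_of_sum_maxStable (by omega) f (- y none) fun j hj => ?_
      have := hy (some ⟨j, by omega⟩)
      rw [sum_hubFamily_some _ (fun v => y (some v)) f hf] at this
      simp only at this
      linarith
    have hn : y none + k * f 0 = 0 := by
      have := hy (some 0)
      rw [sum_hubFamily_some _ (fun v => y (some v)) f hf] at this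
      rw [← this, ← sum_ite_maxStable (Nat.zero_le (2 * k))]
      congr 1
      refine Finset.sum_congr rfl fun i hi => ?_
      rw [hc i (by rw [Finset.mem_range] at hi; omega)]
      rfl
    have h0 := hy none
    rw [sum_hubFamily_none, ← hf] at h0
    refine ⟨f 0, by linarith, ?_⟩
    rintro (_ | i)
    · have : f ((0 : Fin (2 * k + 1)) : ℕ) = f 0 := rfl
      simp only [Option.elim]
      rw [this] at h0
      linarith
    · rw [← hf, hc i (by omega)]
      simp
  · rintro (_ | u) (_ | v)
    · rfl
    · rfl
    · rfl
    · simp only [hubDir]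
      rw [wheelDir_comm]
  all_goals
    have hd : ∑ i : Fin (2 * k + 1), (wheelDir k i i : ℝ) = 1 := by
      have : ∀ i : Fin (2 * k + 1), (wheelDir k i i : ℝ) = if i = 0 then 1 else 0 := by
        intro i
        simp only [wheelDir_self, fin_val_eq_zero_iff]
        split_ifs <;> simp
      simp [this]
    simp only [Fintype.sum_option, Option.elim, one_mul, hubDir, Int.cast_zero,
      mul_zero, Finset.sum_const_zero, zero_add, hd]
  · exact one_pos
  · have h : ∑ i : Fin (2 * k + 1), ∑ l : Fin (2 * k + 1), wheelDir k i l = 4 * k - 3 := by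
      have hr : ∀ i, ∑ l : Fin (2 * k + 1), wheelDir k i l
          = ∑ l ∈ Finset.range (2 * k + 1), wheelDir k i l := fun i => (Finset.sum_range _).symm
      simp only [hr]
      -- Only row 0 contributes, so the required inequality is 2k < 4k - 3, true for k ≥ 2.
      rw [Finset.sum_eq_single 0 (fun i _ hi => ?_) (by simp)]
      · exact sum_wheelDir_zero hk
      · rw [Ne, fin_val_eq_zero_iff] at hi
        exact sum_wheelDir_of_pos hk (by omega) (by omega)
    have h' : ∑ i : Fin (2 * k + 1), ∑ l : Fin (2 * k + 1), (wheelDir k i l : ℝ) = 4 * k - 3 := by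
      exact_mod_cast h
    rw [h']
    have : (2 : ℝ) ≤ k := by exact_mod_cast hk
    linarith

end Hub

/-! ### The complement of an odd cycle: tight pairs, direction and violating point -/

section Antiwheel

/-- The complement of the cycle `0, 1, …, 2k`, with a hub that is adjacent to all nodes but `0`. -/
def antiwheelMinusSpoke (k : ℕ) : SimpleGraph (Option (Fin (2 * k + 1))) where
  Adj
    | none, none => False
    | none, some i => (i : ℕ) ≠ 0
    | some i, none => (i : ℕ) ≠ 0
    | some i, some j => i ≠ j ∧ ¬ CycAdj k i j
  symm := ⟨by
    rintro (_ | i) (_ | j) h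
    · exact h
    · exact h
    · exact h
    · exact ⟨h.1.symm, fun h' => h.2 h'.symm⟩⟩
  loopless := ⟨by
    rintro (_ | i) h
    · exact h
    · exact h.1 rfl⟩

/-- `i` is an end of the edge from `j` to its successor in the cycle `0, 1, …, 2k`. -/
def CycEdge (k j i : ℕ) : Prop := i = j ∨ i = j + 1 ∨ (j = 2 * k ∧ i = 0)

instance (k : ℕ) : DecidableRel (CycEdge k) := fun j i => by
  unfold CycEdge; infer_instance

/-- The perturbation for the antiwheel, on the rim. -/
def antiwheelDir (k i l : ℕ) : ℤ :=
  if i = 0 ∧ l = 0 then 1 else if (i = 0 ∧ l = 2 * k) ∨ (i = 2 * k ∧ l = 0) then 2 else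
    if i + 1 = l then (if i % 2 = 0 then 2 else -2) else
      if l + 1 = i then (if l % 2 = 0 then 2 else -2) else 0

lemma antiwheelDir_comm (k i l : ℕ) : antiwheelDir k i l = antiwheelDir k l i := by
  unfold antiwheelDir
  split_ifs <;> omega

lemma antiwheelDir_self {k : ℕ} (hk : 2 ≤ k) (i : ℕ) :
    antiwheelDir k i i = if i = 0 then 1 else 0 := by
  unfold antiwheelDir
  split_ifs <;> omega

lemma antiwheelDir_of_not_cycAdj {k i l : ℕ} (hne : i ≠ l) (h : ¬ CycAdj k i l) :
    antiwheelDir k i l = 0 := by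
  unfold CycAdj at h
  unfold antiwheelDir
  split_ifs <;> omega

lemma sum_ite_cycEdge {k j : ℕ} (hk : 1 ≤ k) (hj : j ≤ 2 * k) (f : ℕ → ℝ) :
    ∑ i ∈ Finset.range (2 * k + 1), (if CycEdge k j i then f i else 0)
      = f j + f (if j = 2 * k then 0 else j + 1) := by
  obtain ⟨s, hs⟩ : ∃ s, s = if j = 2 * k then 0 else j + 1 := ⟨_, rfl⟩
  have hsj : s ≠ j := by split_ifs at hs <;> omega
  have hsk : s ≤ 2 * k := by split_ifs at hs <;> omega
  rw [← hs]
  have : ∀ i ∈ Finset.range (2 * k + 1), (if CycEdge k j i then f i else 0)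
      = (if j = i then f i else 0) + (if s = i then f i else 0) := by
    intro i hi
    rw [Finset.mem_range] at hi
    have hiff : CycEdge k j i ↔ j = i ∨ s = i := by
      unfold CycEdge
      split_ifs at hs <;> omega
    simp only [hiff]
    rcases eq_or_ne j i with rfl | h
    · simp [hsj]
    · simp [h]
  rw [Finset.sum_congr rfl this, Finset.sum_add_distrib, Finset.sum_ite_eq, Finset.sum_ite_eq,
    if_pos (Finset.mem_range.2 (by omega)), if_pos (Finset.mem_range.2 (by omega))]

lemma sum_antiwheelDir_zero {k : ℕ} (hk : 2 ≤ k) :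
    ∑ l ∈ Finset.range (2 * k + 1), antiwheelDir k 0 l = 5 := by
  have : ∀ l ∈ Finset.range (2 * k + 1), antiwheelDir k 0 l = (if 0 = l then 1 else 0)
      + (if 1 = l then 2 else 0) + (if 2 * k = l then 2 else 0) := by
    intro l hl
    rw [Finset.mem_range] at hl
    unfold antiwheelDir
    split_ifs <;> first | contradiction | omega
  rw [Finset.sum_congr rfl this]
  simp only [Finset.sum_add_distrib, Finset.sum_ite_eq, Finset.mem_range]
  rw [if_pos (by omega), if_pos (by omega), if_pos (by omega)]
  norm_num

/-- The signs alternate along the cycle edges from {0, 1} to {2k, 0}, so the two entries of a row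
cancel except at 0, where both are 2. -/
lemma sum_antiwheelDir_of_pos {k i : ℕ} (hk : 2 ≤ k) (hi : 1 ≤ i) (hi' : i ≤ 2 * k) :
    ∑ l ∈ Finset.range (2 * k + 1), antiwheelDir k i l = 0 := by
  have : ∀ l ∈ Finset.range (2 * k + 1), antiwheelDir k i l
      = (if i - 1 = l then (if i % 2 = 0 then -2 else 2) else 0)
      + (if (if i = 2 * k then 0 else i + 1) = l then (if i % 2 = 0 then 2 else -2) else 0) := by
    intro l hl
    rw [Finset.mem_range] at hl
    unfold antiwheelDir
    split_ifs <;> omega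
  rw [Finset.sum_congr rfl this]
  simp only [Finset.sum_add_distrib, Finset.sum_ite_eq, Finset.mem_range]
  split_ifs <;> omega

lemma antiwheelDir_nonneg_or {k u v : ℕ} (hu : u ≤ 2 * k) (hv : v ≤ 2 * k) :
    0 ≤ antiwheelDir k u v ∨ ∃ j ≤ 2 * k, CycEdge k j u ∧ CycEdge k j v := by
  rw [or_iff_not_imp_left]
  intro h
  have : u + 1 = v ∨ v + 1 = u := by
    by_contra h'
    apply h
    unfold antiwheelDir
    split_ifs <;> omega
  rcases this with rfl | rfl
  · exact ⟨u, by omega, by simp [CycEdge], by simp [CycEdge]⟩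
  · exact ⟨v, by omega, by simp [CycEdge], by simp [CycEdge]⟩

lemma exists_cycEdge_mem_notMem {k i u : ℕ} (hk : 2 ≤ k) (hi : i ≤ 2 * k) (hu : u ≤ 2 * k)
    (hne : i ≠ u) : ∃ j ≤ 2 * k, CycEdge k j i ∧ ¬ CycEdge k j u := by
  by_cases h : CycEdge k i u
  · refine ⟨if i = 0 then 2 * k else i - 1, by split_ifs <;> omega, ?_, ?_⟩ <;>
      revert h <;> unfold CycEdge <;> split_ifs <;> omega
  · exact ⟨i, hi, Or.inl rfl, h⟩

/-- Each node lies on two cycle edges, so two nodes meet at most four of the five edges tested. -/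
lemma exists_cycEdge_notMem_notMem {k i u : ℕ} (hk : 2 ≤ k) :
    ∃ j ≤ 2 * k, ¬ CycEdge k j i ∧ ¬ CycEdge k j u := by
  by_contra! h
  have h0 := h 0 (by omega)
  have h1 := h 1 (by omega)
  have h2 := h 2 (by omega)
  have h3 := h 3 (by omega)
  have h4 := h (2 * k) le_rfl
  unfold CycEdge at *
  omega

/-- If i differs from u, v and 0, and neither cycle edge at i avoids u and v, then u and v are the
two cycle neighbours of i and their entries cancel. -/
lemma antiwheelDir_column {k i u v : ℕ} (hk : 2 ≤ k) (hi : i ≤ 2 * k) (hu : u ≤ 2 * k)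
    (hv : v ≤ 2 * k) (hne : u ≠ v) (huv : ¬ CycAdj k u v) :
    0 ≤ antiwheelDir k i i - antiwheelDir k i u - antiwheelDir k i v ∨
      (∃ j ≤ 2 * k, CycEdge k j i ∧ ¬ CycEdge k j u ∧ ¬ CycEdge k j v) ∨
      (i = 0 ∧ u ≠ 0 ∧ v ≠ 0) := by
  rcases eq_or_ne i u with rfl | hiu
  · left
    rw [antiwheelDir_of_not_cycAdj hne huv]
    omega
  rcases eq_or_ne i v with rfl | hiv
  · left
    rw [antiwheelDir_of_not_cycAdj hne.symm (mt CycAdj.symm huv)]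
    omega
  rcases Nat.eq_zero_or_pos i with rfl | hi0
  · exact Or.inr (Or.inr ⟨rfl, hiu.symm, hiv.symm⟩)
  by_cases h1 : ¬ CycEdge k i u ∧ ¬ CycEdge k i v
  · exact Or.inr (Or.inl ⟨i, hi, Or.inl rfl, h1⟩)
  by_cases h2 : ¬ CycEdge k (i - 1) u ∧ ¬ CycEdge k (i - 1) v
  · exact Or.inr (Or.inl ⟨i - 1, by omega, Or.inr (Or.inl (by omega)), h2⟩)
  left
  rw [antiwheelDir_self hk, if_neg (by omega)]
  have h3 : (u + 1 = i ∧ (i + 1 = v ∨ i = 2 * k ∧ v = 0)) ∨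
      (v + 1 = i ∧ (i + 1 = u ∨ i = 2 * k ∧ u = 0)) := by
    unfold CycEdge at h1 h2
    omega
  unfold antiwheelDir
  rcases h3 with ⟨h3, h4⟩ | ⟨h3, h4⟩ <;> split_ifs <;> omega

lemma antiwheelDir_complement_two : ∀ i u v : Fin 5, u ≠ v → ¬ CycAdj 2 u v →
    (0 ≤ - antiwheelDir 2 i i - antiwheelDir 2 u u - antiwheelDir 2 v v + antiwheelDir 2 i u
      + antiwheelDir 2 i v ∨
      (∃ j : Fin 5, ¬ CycEdge 2 j i ∧ ¬ CycEdge 2 j u ∧ ¬ CycEdge 2 j v) ∨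
      (i.val ≠ 0 ∧ u.val ≠ 0 ∧ v.val ≠ 0)) := by
  decide

lemma antiwheelDir_complement {k i u v : ℕ} (hk : 2 ≤ k) (hi : i ≤ 2 * k) (hu : u ≤ 2 * k)
    (hv : v ≤ 2 * k) (hne : u ≠ v) (huv : ¬ CycAdj k u v) :
    0 ≤ - antiwheelDir k i i - antiwheelDir k u u - antiwheelDir k v v + antiwheelDir k i u
      + antiwheelDir k i v ∨
      (∃ j ≤ 2 * k, ¬ CycEdge k j i ∧ ¬ CycEdge k j u ∧ ¬ CycEdge k j v) ∨
      (i ≠ 0 ∧ u ≠ 0 ∧ v ≠ 0) := by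
  rcases hk.eq_or_lt with rfl | hk'
  · refine (antiwheelDir_complement_two ⟨i, by omega⟩ ⟨u, by omega⟩ ⟨v, by omega⟩
      (by simpa using hne) huv).imp id (Or.imp ?_ id)
    rintro ⟨j, h⟩
    exact ⟨j, by omega, h⟩
  · right
    by_contra! h
    obtain ⟨h, h0⟩ := h
    -- The cycle edges {1, 2}, {3, 4}, {5, 6} are disjoint and exist as k ≥ 3. If i, u, v meet all
    -- three, then none of them is 0.
    have h1 := h 1 (by omega)
    have h3 := h 3 (by omega)
    have h5 := h 5 (by omega)
    unfold CycEdge at *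
    omega

variable {k : ℕ}

lemma antiwheel_nonneg_or (u v : Option (Fin (2 * k + 1))) :
    0 ≤ hubDir k (antiwheelDir k) u v ∨
      ∃ j, u ∈ hubFamily k (CycEdge k) j ∧ v ∈ hubFamily k (CycEdge k) j := by
  match u, v with
  | none, _ => exact Or.inl le_rfl
  | some _, none => exact Or.inl le_rfl
  | some u, some v =>
    refine (antiwheelDir_nonneg_or (k := k) (by omega : (u : ℕ) ≤ 2 * k)
      (by omega : (v : ℕ) ≤ 2 * k)).imp id fun h => ?_
    obtain ⟨j, h1, h2⟩ := exists_fin_of_exists_nat h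
    exact ⟨some j, some_mem_hubFamily.2 h1, some_mem_hubFamily.2 h2⟩

lemma antiwheel_column (hk : 2 ≤ k) (i u v : Option (Fin (2 * k + 1)))
    (huv : (antiwheelMinusSpoke k).Adj u v) :
    0 ≤ hubDir k (antiwheelDir k) i i - hubDir k (antiwheelDir k) i u
        - hubDir k (antiwheelDir k) i v ∨
      ∃ j, i ∈ hubFamily k (CycEdge k) j ∧ u ∉ hubFamily k (CycEdge k) j ∧
        v ∉ hubFamily k (CycEdge k) j := by
  have key : ∀ i u : Fin (2 * k + 1), 0 ≤ antiwheelDir k i i - antiwheelDir k i u ∨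
      ∃ j, some i ∈ hubFamily k (CycEdge k) j ∧ some u ∉ hubFamily k (CycEdge k) j ∧
        none ∉ hubFamily k (CycEdge k) j := by
    intro i u
    rcases eq_or_ne i u with rfl | h
    · left; omega
    · right
      obtain ⟨j, h1, h2⟩ := exists_fin_of_exists_nat (exists_cycEdge_mem_notMem hk
        (by omega : (i : ℕ) ≤ 2 * k) (by omega : (u : ℕ) ≤ 2 * k) (by omega))
      exact ⟨some j, some_mem_hubFamily.2 h1, mt some_mem_hubFamily.1 h2,
        none_notMem_hubFamily⟩
  match i, u, v, huv with
  | none, _, _, _ => exact Or.inl le_rfl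
  | some i, none, some v, _ =>
    refine (key i v).imp (fun h => ?_) ?_
    · simpa [hubDir] using h
    · rintro ⟨j, h1, h2, h3⟩
      exact ⟨j, h1, h3, h2⟩
  | some i, some u, none, _ =>
    refine (key i u).imp (fun h => ?_) id
    simpa [hubDir] using h
  | some i, some u, some v, huv =>
    have hne : (u : ℕ) ≠ v := fun h => huv.1 (Fin.ext h)
    rcases antiwheelDir_column hk (by omega : (i : ℕ) ≤ 2 * k) (by omega) (by omega) hne huv.2
      with h | h | ⟨h1, h2, h3⟩
    · exact Or.inl h
    · right
      obtain ⟨j, h1, h2, h3⟩ := exists_fin_of_exists_nat h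
      exact ⟨some j, some_mem_hubFamily.2 h1, mt some_mem_hubFamily.1 h2,
        mt some_mem_hubFamily.1 h3⟩
    · right
      refine ⟨none, ?_, ?_, ?_⟩ <;> simp [mem_hubFamily_none, fin_val_eq_zero_iff, h1, h2, h3]

lemma antiwheel_complement (hk : 2 ≤ k) (i u v : Option (Fin (2 * k + 1)))
    (huv : (antiwheelMinusSpoke k).Adj u v) :
    0 ≤ - hubDir k (antiwheelDir k) i i - hubDir k (antiwheelDir k) u u
        - hubDir k (antiwheelDir k) v v + hubDir k (antiwheelDir k) i u
        + hubDir k (antiwheelDir k) i v ∨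
      ∃ j, i ∉ hubFamily k (CycEdge k) j ∧ u ∉ hubFamily k (CycEdge k) j ∧
        v ∉ hubFamily k (CycEdge k) j := by
  have key : ∀ i u : Fin (2 * k + 1), ∃ j, some i ∉ hubFamily k (CycEdge k) (some j) ∧
      some u ∉ hubFamily k (CycEdge k) (some j) := by
    intro i u
    obtain ⟨j, h1, h2⟩ := exists_fin_of_exists_nat
      (exists_cycEdge_notMem_notMem (i := i) (u := u) hk)
    exact ⟨j, mt some_mem_hubFamily.1 h1, mt some_mem_hubFamily.1 h2⟩
  match i, u, v, huv with
  | none, none, some v, _ =>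
    obtain ⟨j, h1, h2⟩ := key v v
    exact Or.inr ⟨_, none_notMem_hubFamily, none_notMem_hubFamily, h1⟩
  | none, some u, none, _ =>
    obtain ⟨j, h1, h2⟩ := key u u
    exact Or.inr ⟨_, none_notMem_hubFamily, h1, none_notMem_hubFamily⟩
  | none, some u, some v, _ =>
    obtain ⟨j, h1, h2⟩ := key u v
    exact Or.inr ⟨_, none_notMem_hubFamily, h1, h2⟩
  | some i, none, some v, _ =>
    obtain ⟨j, h1, h2⟩ := key i v
    exact Or.inr ⟨_, h1, none_notMem_hubFamily, h2⟩
  | some i, some u, none, _ =>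
    obtain ⟨j, h1, h2⟩ := key i u
    exact Or.inr ⟨_, h1, h2, none_notMem_hubFamily⟩
  | some i, some u, some v, huv =>
    have hne : (u : ℕ) ≠ v := fun h => huv.1 (Fin.ext h)
    rcases antiwheelDir_complement hk (by omega : (i : ℕ) ≤ 2 * k) (by omega) (by omega) hne huv.2
      with h | h | ⟨h1, h2, h3⟩
    · exact Or.inl h
    · right
      obtain ⟨j, h1, h2, h3⟩ := exists_fin_of_exists_nat h
      exact ⟨some j, mt some_mem_hubFamily.1 h1, mt some_mem_hubFamily.1 h2,
        mt some_mem_hubFamily.1 h3⟩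
    · right
      refine ⟨none, ?_, ?_, ?_⟩ <;> simp [mem_hubFamily_none, fin_val_eq_zero_iff, h1, h2, h3]

/-- The values repeat with period two, and since the cycle is odd the closing edge joins two equal
values. -/
lemma const_of_add_succ_eq (f : ℕ → ℝ) (b : ℝ) (h : ∀ j < 2 * k, f j + f (j + 1) = b)
    (h0 : f (2 * k) + f 0 = b) : ∀ i ≤ 2 * k, f i = b / 2 := by
  have step : ∀ m ≤ k, f (2 * m) = f 0 := by
    intro m
    induction m with
    | zero => intro; rfl
    | succ m ih =>
      intro hm
      have h1 := h (2 * m) (by omega)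
      have h2 := h (2 * m + 1) (by omega)
      rw [show 2 * (m + 1) = 2 * m + 1 + 1 by ring]
      linarith [ih (by omega)]
  have hf0 : f 0 = b / 2 := by linarith [step k le_rfl]
  intro i hi
  induction i with
  | zero => exact hf0
  | succ i ih => linarith [ih (by omega), h i (by omega)]

/-- For the complement of an odd cycle with a hub that misses one node, `LS₊` violates the bound
`2` on the sum of the coordinates. -/
theorem exists_mem_LSPlus_antiwheelMinusSpoke (hk : 2 ≤ k) :
    ∃ x ∈ LSPlus (edgeRelaxation (antiwheelMinusSpoke k)),
      2 < ∑ i, x (some i) + x none := by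
  suffices h : ∃ x ∈ LSPlus (edgeRelaxation (antiwheelMinusSpoke k)),
      (2 : ℝ) < ∑ v : Option (Fin (2 * k + 1)), 1 * x v by
    obtain ⟨x, hx, hlt⟩ := h
    refine ⟨x, hx, hlt.trans_eq ?_⟩
    rw [Fintype.sum_option]
    simp [add_comm]
  refine exists_mem_LSPlus_lt (G := antiwheelMinusSpoke k) ?_ (hubFamily k (CycEdge k)) ?_
    (fun _ => 1) 2 ?_ ?_
    (fun u v => (hubDir k (antiwheelDir k) u v : ℝ)) ?_
    (fun u v => by exact_mod_cast antiwheel_nonneg_or u v)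
    (fun i u v huv => by exact_mod_cast antiwheel_column hk i u v huv)
    (fun i u v huv => by exact_mod_cast antiwheel_complement hk i u v huv) ?_ ?_
  · rintro (_ | i)
    · exact ⟨some ⟨1, by omega⟩, by simp [antiwheelMinusSpoke]⟩
    · rcases eq_or_ne (i : ℕ) 0 with h | h
      · refine ⟨some ⟨2, by omega⟩, ?_⟩
        simp only [antiwheelMinusSpoke, CycAdj, ne_eq, Fin.ext_iff]
        omega
      · exact ⟨none, h⟩
  · rintro (_ | j) (_ | u) (_ | v) hu hv huv
    all_goals simp only [antiwheelMinusSpoke, CycAdj, mem_hubFamily_none, some_mem_hubFamily,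
      none_notMem_hubFamily, CycEdge, Option.some.injEq, Fin.val_zero, reduceCtorEq,
      false_or, ne_eq, Fin.ext_iff] at hu hv huv
    all_goals omega
  · rintro (_ | j)
    · rw [sum_hubFamily_none]
      norm_num
    · rw [sum_hubFamily_some j _ (fun _ => 1) (fun _ => rfl),
        sum_ite_cycEdge (by omega) (by omega)]
      norm_num
  · intro y hy
    let f : ℕ → ℝ := fun i => if h : i < 2 * k + 1 then y (some (some ⟨i, h⟩)) else 0
    have hf : ∀ i : Fin (2 * k + 1), f i = y (some (some i)) := fun i => dif_pos i.isLt
    have hsum : ∀ j ≤ 2 * k, f j + f (if j = 2 * k then 0 else j + 1) = - y none := by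
      intro j hj
      have := hy (some ⟨j, by omega⟩)
      rw [sum_hubFamily_some _ (fun v => y (some v)) f hf, sum_ite_cycEdge (by omega) hj] at this
      linarith
    have hc := const_of_add_succ_eq (k := k) f (- y none)
      (fun j hj => by simpa [hj.ne] using hsum j hj.le) (by simpa using hsum (2 * k) le_rfl)
    have h0 := hy none
    rw [sum_hubFamily_none, ← hf] at h0
    refine ⟨- y none / 2, by ring, ?_⟩
    rintro (_ | i)
    · have : f ((0 : Fin (2 * k + 1)) : ℕ) = - y none / 2 := hc 0 (by omega)
      rw [this] at h0
      linarith
    · rw [← hf, hc i (by omega)]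
      ring
  · rintro (_ | u) (_ | v)
    · rfl
    · rfl
    · rfl
    · simp only [hubDir]
      rw [antiwheelDir_comm]
  all_goals
    have hd : ∑ i : Fin (2 * k + 1), (antiwheelDir k i i : ℝ) = 1 := by
      have : ∀ i : Fin (2 * k + 1), (antiwheelDir k i i : ℝ) = if i = 0 then 1 else 0 := by
        intro i
        simp only [antiwheelDir_self hk, fin_val_eq_zero_iff]
        split_ifs <;> simp
      simp [this]
    simp only [Fintype.sum_option, one_mul, hubDir, Int.cast_zero, Finset.sum_const_zero,
      zero_add, hd]
  · exact one_pos
  · have h : ∑ i : Fin (2 * k + 1), ∑ l : Fin (2 * k + 1), antiwheelDir k i l = 5 := by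
      have hr : ∀ i, ∑ l : Fin (2 * k + 1), antiwheelDir k i l
          = ∑ l ∈ Finset.range (2 * k + 1), antiwheelDir k i l := fun i => (Finset.sum_range _).symm
      simp only [hr]
      rw [Finset.sum_eq_single 0 (fun i _ hi => ?_) (by simp)]
      · exact sum_antiwheelDir_zero hk
      · rw [Ne, fin_val_eq_zero_iff] at hi
        exact sum_antiwheelDir_of_pos hk (by omega) (by omega)
    have h' : ∑ i : Fin (2 * k + 1), ∑ l : Fin (2 * k + 1), (antiwheelDir k i l : ℝ) = 5 := by
      exact_mod_cast h
    rw [h']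
    norm_num

end Antiwheel

/-! ### From a violating point of the base graph to non-perfectness -/

section Transfer

variable {V W U : Type*}

lemma Literal.compatible_comm {B : SimpleGraph W} {l l' : Literal W} (h : l.Compatible B l') :
    l'.Compatible B l := by
  cases l <;> cases l' <;> simp_all [Literal.Compatible, SimpleGraph.adj_comm]

variable [Fintype V] [DecidableEq V] [Fintype W] [DecidableEq W] [Fintype U]

/-- If an inequality on the nodes `g a` is valid for the stable sets of `G`, and violated by a
point of `LS₊` pulled back along literals, then `G` is not `LS₊`-perfect. -/
theorem not_isLSPlusPerfect_of_literals [Nonempty W] {G : SimpleGraph V} {B : SimpleGraph W}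
    {g : U → V} (hg : Function.Injective g) {L : U → Literal W}
    (hL : ∀ a b, G.Adj (g a) (g b) → (L a).Compatible B (L b)) {x : W → ℝ}
    (hx : x ∈ LSPlus (edgeRelaxation B)) (w : U → ℝ) (b : ℝ)
    (hvalid : ∀ T : Set V, G.IsIndepSet T → ∑ a, w a * T.indicator 1 (g a) ≤ b)
    (hlt : b < ∑ a, w a * (L a).eval (homVec x)) : ¬ IsLSPlusPerfect G := by
  intro hG
  -- Nodes outside the range of g receive the literal 0, which is compatible with every literal.
  have hL' : ∀ u v, G.Adj u v → (Function.extend g L (fun _ => .zero) u).Compatible B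
      (Function.extend g L (fun _ => .zero) v) := by
    intro u v huv
    by_cases hu : ∃ a, g a = u
    · obtain ⟨a, rfl⟩ := hu
      by_cases hv : ∃ b, g b = v
      · obtain ⟨b, rfl⟩ := hv
        rw [hg.extend_apply, hg.extend_apply]
        exact hL a b huv
      · rw [Function.extend_apply' _ _ v hv]
        exact Literal.compatible_comm trivial
    · rw [Function.extend_apply' _ _ u hu]
      trivial
  have hmem := LSPlus_edgeRelaxation_subst hL' hx
  rw [hG] at hmem
  have hsub : stableSetPolytope G ⊆ {y : V → ℝ | ∑ a, w a * y (g a) ≤ b} := by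
    refine convexHull_min ?_ ?_
    · rintro _ ⟨T, hT, rfl⟩
      exact hvalid T hT
    · refine convex_halfSpace_le (f := fun y : V → ℝ => ∑ a, w a * y (g a)) ?_ b
      constructor
      · intro y z
        simp [mul_add, Finset.sum_add_distrib]
      · intro c y
        simp only [Pi.smul_apply, smul_eq_mul, Finset.mul_sum]
        exact Finset.sum_congr rfl fun _ _ => by ring
  have h := hsub hmem
  simp only [Set.mem_ofPred_eq, hg.extend_apply] at h
  exact absurd h (not_le.2 hlt)

end Transfer

/-! ### The walk along the rim that contracts it to a smaller wheel -/

section Walk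

variable (N : ℕ → Bool)

/-- Going along the rim from `0`, nodes off `N` are paired with their successors; `walkPaired N i`
says that `i` is the second node of a pair. -/
def walkPaired : ℕ → Bool
  | 0 => false
  | i + 1 => !walkPaired i && !N i

/-- The unpaired nodes of `N`. -/
def walkAdvance (i : ℕ) : Bool := N i && !walkPaired N i

/-- The node of the smaller wheel that `i` is mapped to. -/
def walkPos : ℕ → ℕ
  | 0 => 0
  | 1 => 1
  | i + 2 => walkPos (i + 1) + if walkAdvance N (i + 2) then 1 else 0

/-- The nodes that are mapped to negated variables: the first ones of the pairs after `{0, 1}`. -/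
def walkNeg (i : ℕ) : Bool := decide (2 ≤ i) && !walkPaired N i && !N i

variable {N}

lemma walkPos_succ {i : ℕ} (hi : 1 ≤ i) :
    walkPos N (i + 1) = walkPos N i + if walkAdvance N (i + 1) then 1 else 0 := by
  obtain ⟨i, rfl⟩ := Nat.exists_eq_add_of_le' hi
  rfl

lemma walkPos_mono : Monotone (walkPos N) := by
  refine monotone_nat_of_le_succ fun i => ?_
  rcases Nat.eq_zero_or_pos i with rfl | hi
  · simp [walkPos]
  · rw [walkPos_succ hi]
    omega

lemma walk_step_of_neg {i : ℕ} (h : walkNeg N i = true) :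
    walkNeg N (i + 1) = false ∧ walkPos N (i + 1) = walkPos N i := by
  simp only [walkNeg, Bool.and_eq_true, decide_eq_true_eq, Bool.not_eq_true'] at h
  have hp : walkPaired N (i + 1) = true := by simp [walkPaired, h.1.2, h.2]
  refine ⟨by simp [walkNeg, hp], ?_⟩
  rw [walkPos_succ (by omega)]
  simp [walkAdvance, hp]

lemma walkPaired_succ_of_not_neg {i : ℕ} (h0 : N 0 = false) (hi : 1 ≤ i)
    (h : walkNeg N i = false) : walkPaired N (i + 1) = false := by
  rcases hi.eq_or_lt with rfl | hi
  · simp [walkPaired, h0]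
  · have hi' : 2 ≤ i := hi
    simpa [walkNeg, hi', walkPaired] using h

lemma walk_step_of_not_neg {i : ℕ} (h0 : N 0 = false) (hi : 1 ≤ i) (h : walkNeg N i = false) :
    (N (i + 1) = true ∧ walkNeg N (i + 1) = false ∧ walkPos N (i + 1) = walkPos N i + 1) ∨
    (N (i + 1) = false ∧ walkNeg N (i + 1) = true ∧ walkPos N (i + 1) = walkPos N i) := by
  have hp := walkPaired_succ_of_not_neg h0 hi h
  rw [walkPos_succ hi]
  have hi' : 2 ≤ i + 1 := by omega
  cases hN : N (i + 1) <;> simp [walkNeg, walkAdvance, hp, hN, hi']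

/-- Sums along the walk: `X` gives the values of the variables of the smaller wheel, and `t` is the
incidence vector of a stable set off `N`. -/
lemma walk_sum (h0 : N 0 = false) (X : ℕ → ℝ) (i : ℕ) (hi : 1 ≤ i) : ∃ s : ℕ,
    i = walkPos N i + 2 * s + (if walkNeg N i then 1 else 0) ∧
    ∑ l ∈ Finset.range (i + 1), (if walkNeg N l then 1 - X (walkPos N l) else X (walkPos N l))
      = ∑ u ∈ Finset.range (walkPos N i + 1), X u + s
        + (if walkNeg N i then 1 - X (walkPos N i) else 0) ∧
    ∀ t : ℕ → ℝ, (∀ l < i, t l + t (l + 1) ≤ 1) → (∀ l ≤ i, N l = true → t l = 0) →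
      ∑ l ∈ Finset.range (i + 1), t l ≤ 1 + s + if walkNeg N i then t i else 0 := by
  -- Here s counts the completed pairs after {0, 1}. A pair has literals 1 - x and x, adding 1 to
  -- the literal sum and at most 1 to the sum of t; an advance adds a new variable, and t vanishes
  -- there. The pair {0, 1} accounts for the constant 1.
  induction i, hi using Nat.le_induction with
  | base =>
    refine ⟨0, by simp [walkPos, walkNeg], ?_, fun t ht _ => ?_⟩
    · simp [walkPos, walkNeg, Finset.sum_range_succ]
    · simpa [walkNeg, Finset.sum_range_succ] using ht 0 one_pos
  | succ i hi ih =>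
    obtain ⟨s, h1, h2, h3⟩ := ih
    cases hneg : walkNeg N i with
    | true =>
      obtain ⟨h4, h5⟩ := walk_step_of_neg hneg
      simp only [hneg, if_true] at h1 h2 h3
      refine ⟨s + 1, ?_, ?_, fun t ht ht' => ?_⟩
      · rw [h4, h5]
        simp only [Bool.false_eq_true, if_false]
        omega
      · rw [Finset.sum_range_succ, h2, h4, h5]
        simp only [Bool.false_eq_true, if_false]
        push_cast
        ring
      · have := h3 t (fun l hl => ht l (by omega)) (fun l hl => ht' l (by omega))
        rw [Finset.sum_range_succ, h4]
        simp only [Bool.false_eq_true, if_false]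
        push_cast
        linarith [ht i (by omega)]
    | false =>
      simp only [hneg, Bool.false_eq_true, if_false, add_zero] at h1 h2 h3
      refine ⟨s, ?_⟩
      rcases walk_step_of_not_neg h0 hi hneg with ⟨hN, h4, h5⟩ | ⟨hN, h4, h5⟩
      · rw [h4, h5]
        simp only [Bool.false_eq_true, if_false, add_zero]
        refine ⟨by omega, ?_, fun t ht ht' => ?_⟩
        · rw [Finset.sum_range_succ, h2, h4, h5, Finset.sum_range_succ _ (walkPos N i + 1)]
          simp only [Bool.false_eq_true, if_false]
          ring
        · have := h3 t (fun l hl => ht l (by omega)) (fun l hl => ht' l (by omega))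
          rw [Finset.sum_range_succ, ht' (i + 1) le_rfl hN]
          linarith
      · rw [h4, h5]
        simp only [if_true]
        refine ⟨by omega, ?_, fun t ht ht' => ?_⟩
        · rw [Finset.sum_range_succ, h2, h4, h5]
          simp only [if_true]
        · have := h3 t (fun l hl => ht l (by omega)) (fun l hl => ht' l (by omega))
          rw [Finset.sum_range_succ]
          linarith

/-- Nodes 0 and 1 are never advances (0 is off N, and 1 is paired with 0), yet node 1 already has
position 1; two later advances add 2. -/
lemma three_le_walkPos {a b i : ℕ} (h0 : N 0 = false) (hab : a < b) (hb : b ≤ i)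
    (ha' : walkAdvance N a = true) (hb' : walkAdvance N b = true) : 3 ≤ walkPos N i := by
  have h2 : 2 ≤ a := by
    by_contra h
    have : a = 0 ∨ a = 1 := by omega
    rcases this with rfl | rfl
    · simp [walkAdvance, h0] at ha'
    · simp [walkAdvance, walkPaired, h0] at ha'
  obtain ⟨a, rfl⟩ := Nat.exists_eq_add_of_le' (show 1 ≤ a by omega)
  obtain ⟨b, rfl⟩ := Nat.exists_eq_add_of_le' (show 1 ≤ b by omega)
  have e1 := walkPos_succ (N := N) (show 1 ≤ a by omega)
  have e2 := walkPos_succ (N := N) (show 1 ≤ b by omega)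
  rw [ha', if_pos rfl] at e1
  rw [hb', if_pos rfl] at e2
  have e3 : walkPos N 1 ≤ walkPos N a := walkPos_mono (by omega)
  have e4 : walkPos N (a + 1) ≤ walkPos N b := walkPos_mono (by omega)
  have e5 : walkPos N (b + 1) ≤ walkPos N i := walkPos_mono hb
  simp only [walkPos] at e3
  omega

/-- Pairing consecutive nodes leaves over either the first or the last one. One of them contributes
at most 0: node 0 if t 0 = 0, and node 2k, by the closing edge, if t 0 = 1. -/
lemma sum_range_le_of_cycle {k : ℕ} {t : ℕ → ℝ} (ht : ∀ l < 2 * k, t l + t (l + 1) ≤ 1)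
    (ht0 : t 0 + t (2 * k) ≤ 1) (h01 : t 0 = 0 ∨ t 0 = 1) :
    ∑ l ∈ Finset.range (2 * k + 1), t l ≤ k := by
  have key : ∀ m ≤ k, ∑ l ∈ Finset.range (2 * m + 1), t l ≤ m + t 0 ∧
      ∑ l ∈ Finset.range (2 * m + 1), t l ≤ m + t (2 * m) := by
    intro m
    induction m with
    | zero => simp
    | succ m ih =>
      intro hm
      obtain ⟨h1, h2⟩ := ih (by omega)
      have h3 := ht (2 * m) (by omega)
      have h4 := ht (2 * m + 1) (by omega)
      rw [show 2 * (m + 1) = 2 * m + 1 + 1 by ring, Finset.sum_range_succ, Finset.sum_range_succ]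
      push_cast
      constructor <;> linarith
  obtain ⟨h1, h2⟩ := key k le_rfl
  rcases h01 with h | h <;> linarith

/-- The literal of the smaller wheel that belongs to node `i` of the rim. -/
def walkLiteral (N : ℕ → Bool) (K i : ℕ) : Literal (Option (Fin (2 * K + 1))) :=
  if walkNeg N i then .neg (some (Fin.ofNat _ (walkPos N i)))
  else .pos (some (Fin.ofNat _ (walkPos N i)))

lemma walkLiteral_compatible_succ {K i : ℕ} (hK : 2 ≤ K) (h0 : N 0 = false)
    (hpos : walkPos N (i + 1) ≤ 2 * K) :
    (walkLiteral N K i).Compatible (wheelMinusSpoke K) (walkLiteral N K (i + 1)) := by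
  rcases Nat.eq_zero_or_pos i with rfl | hi
  · have h1 : 1 % (2 * K + 1) = 1 := Nat.mod_eq_of_lt (by omega)
    simp [walkLiteral, walkNeg, walkPos, Literal.Compatible, wheelMinusSpoke, CycAdj, h1]
  · have hle : walkPos N i ≤ walkPos N (i + 1) := walkPos_mono (by omega)
    cases hneg : walkNeg N i with
    | true =>
      obtain ⟨h4, h5⟩ := walk_step_of_neg hneg
      simp [walkLiteral, hneg, h4, h5, Literal.Compatible]
    | false =>
      rcases walk_step_of_not_neg h0 hi hneg with ⟨hN, h4, h5⟩ | ⟨hN, h4, h5⟩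
      · have e1 : walkPos N i % (2 * K + 1) = walkPos N i := Nat.mod_eq_of_lt (by omega)
        have e2 : (walkPos N i + 1) % (2 * K + 1) = walkPos N i + 1 :=
          Nat.mod_eq_of_lt (by omega)
        simp [walkLiteral, hneg, h4, h5, Literal.Compatible, wheelMinusSpoke, CycAdj, e1, e2]
      · simp [walkLiteral, hneg, h4, h5, Literal.Compatible]

lemma walkLiteral_compatible {K k : ℕ} (hK : 2 ≤ K) (h0 : N 0 = false) (hlast : N (2 * k) = true)
    (hpos : walkPos N (2 * k) = 2 * K) {i j : ℕ} (hi : i ≤ 2 * k) (hj : j ≤ 2 * k)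
    (hij : CycAdj k i j) :
    (walkLiteral N K i).Compatible (wheelMinusSpoke K) (walkLiteral N K j) := by
  wlog h : i + 1 = j ∨ (i = 2 * k ∧ j = 0) generalizing i j
  · exact Literal.compatible_comm (this hj hi hij.symm (by unfold CycAdj at hij; omega))
  rcases h with rfl | ⟨rfl, rfl⟩
  · exact walkLiteral_compatible_succ hK h0 (hpos ▸ walkPos_mono hj)
  · have h2 : K ≠ 0 := by omega
    simp [walkLiteral, walkNeg, hlast, hpos, Literal.Compatible, wheelMinusSpoke, CycAdj, h2,
      walkPos]

end Walk

/-- An odd cycle with a hub, such that the walk from a non-neighbour after a neighbour of the hub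
has two advances, is an obstruction to `LS₊`-perfectness. -/
theorem not_isLSPlusPerfect_of_wheel {V : Type*} [Fintype V] [DecidableEq V] {G : SimpleGraph V}
    {k : ℕ} {g : Option (Fin (2 * k + 1)) → V} (hg : Function.Injective g)
    (hadj : ∀ i j, G.Adj (g (some i)) (g (some j)) ↔ CycAdj k i j) {N : ℕ → Bool}
    (hN : ∀ i : Fin (2 * k + 1), G.Adj (g none) (g (some i)) ↔ N i = true) (h0 : N 0 = false)
    (hlast : N (2 * k) = true) {a b : ℕ} (hab : a < b) (hb : b ≤ 2 * k)
    (ha' : walkAdvance N a = true) (hb' : walkAdvance N b = true) : ¬ IsLSPlusPerfect G := by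
  have h3 := three_le_walkPos h0 hab hb ha' hb'
  have hneg : walkNeg N (2 * k) = false := by simp [walkNeg, hlast]
  have hk1 : 1 ≤ 2 * k := by omega
  -- The walk ends at a node of N, hence outside an open pair, so 2k equals the final position plus
  -- 2s. That position is even and at least 3, whence K ≥ 2.
  obtain ⟨K, hK⟩ : ∃ K, walkPos N (2 * k) = 2 * K := by
    obtain ⟨s, hs, -⟩ := walk_sum h0 (fun _ => 0) (2 * k) hk1
    rw [hneg] at hs
    simp only [Bool.false_eq_true, if_false] at hs
    exact ⟨k - s, by omega⟩
  have hK2 : 2 ≤ K := by omega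
  obtain ⟨x, hx, hlt⟩ := exists_mem_LSPlus_wheelMinusSpoke hK2
  obtain ⟨s, hs, hsum, hstab⟩ := walk_sum h0
    (fun u => x (some (Fin.ofNat (2 * K + 1) u))) (2 * k) hk1
  rw [hneg, hK] at hs hsum
  simp only [hneg, Bool.false_eq_true, if_false, add_zero] at hs hsum hstab
  have hks : (k : ℝ) = K + s := by exact_mod_cast (by omega : k = K + s)
  have hsmall : ∀ i ≤ 2 * k, walkPos N i % (2 * K + 1) = walkPos N i := fun i hi =>
    Nat.mod_eq_of_lt (by have := hK ▸ walkPos_mono (N := N) hi; omega)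
  -- Neighbours of the hub carry unnegated variables at nonzero positions, where the smaller wheel
  -- has a spoke.
  have hhub : ∀ i : Fin (2 * k + 1), G.Adj (g none) (g (some i)) →
      (Literal.pos none).Compatible (wheelMinusSpoke K) (walkLiteral N K i) := by
    intro i hi
    rw [hN] at hi
    have hi0 : 1 ≤ (i : ℕ) := by
      by_contra h
      rw [show (i : ℕ) = 0 by omega, h0] at hi
      cases hi
    have h1 : walkPos N 1 ≤ walkPos N i := walkPos_mono hi0
    have h1' : walkPos N i ≠ 0 := by
      simp only [walkPos] at h1
      omega
    simp [walkLiteral, walkNeg, hi, Literal.Compatible, wheelMinusSpoke]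
    rw [Nat.dvd_iff_mod_eq_zero, hsmall i (by omega)]
    exact h1'
  refine not_isLSPlusPerfect_of_literals hg
    (L := fun o => o.elim (.pos none) fun i => walkLiteral N K i) ?_ hx
    (fun o => o.elim ((K : ℝ) - 1) fun _ => 1) k ?_ ?_
  · rintro (_ | i) (_ | j) h
    · exact absurd h (G.loopless.irrefl _)
    · exact hhub j h
    · exact Literal.compatible_comm (hhub i h.symm)
    · exact walkLiteral_compatible hK2 h0 hlast hK (by omega) (by omega) ((hadj i j).1 h)
  · intro T hT
    let t : ℕ → ℝ := fun l => T.indicator 1 (g (some (Fin.ofNat (2 * k + 1) l)))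
    have ht01 : ∀ v : V, T.indicator (1 : V → ℝ) v = 0 ∨ T.indicator (1 : V → ℝ) v = 1 := by
      intro v
      by_cases hv : v ∈ T <;> simp [hv]
    have hpair : ∀ u v : V, G.Adj u v →
        T.indicator (1 : V → ℝ) u + T.indicator (1 : V → ℝ) v ≤ 1 := by
      intro u v huv
      by_cases hu : u ∈ T <;> by_cases hv : v ∈ T <;> simp [hu, hv]
      exact (hT hu hv huv.ne huv).elim
    have hval : ∀ l ≤ 2 * k, ((Fin.ofNat (2 * k + 1) l : Fin (2 * k + 1)) : ℕ) = l :=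
      fun l hl => Nat.mod_eq_of_lt (by omega)
    have hcyc : ∀ l l', l ≤ 2 * k → l' ≤ 2 * k → CycAdj k l l' → t l + t l' ≤ 1 := by
      intro l l' hl hl' h
      exact hpair _ _ ((hadj _ _).2 (by rwa [hval l hl, hval l' hl']))
    have htsum : ∑ i : Fin (2 * k + 1), T.indicator (1 : V → ℝ) (g (some i))
        = ∑ l ∈ Finset.range (2 * k + 1), t l := by
      rw [Finset.sum_range]
      refine Finset.sum_congr rfl fun i _ => ?_
      simp only [t]
      congr 3
      exact Fin.ext (hval i (by omega)).symm
    rw [Fintype.sum_option]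
    simp only [Option.elim, one_mul]
    rw [htsum]
    have hsucc : ∀ l < 2 * k, t l + t (l + 1) ≤ 1 := fun l hl =>
      hcyc l (l + 1) (by omega) (by omega) (by unfold CycAdj; omega)
    -- Without the hub, the odd cycle gives the bound k. With it, T avoids N and meets the rim in at
    -- most 1 + s nodes, for a total of (K - 1) + 1 + s = k.
    rcases ht01 (g none) with h | h
    · rw [h, mul_zero, zero_add]
      exact sum_range_le_of_cycle hsucc
        (hcyc _ _ (by omega) le_rfl (by unfold CycAdj; omega)) (ht01 _)
    · have := hstab t hsucc fun l hl hNl => by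
        have hl' : G.Adj (g none) (g (some (Fin.ofNat (2 * k + 1) l))) := by
          rw [hN, hval l hl, hNl]
        have := hpair _ _ hl'
        rw [h] at this
        rcases ht01 (g (some (Fin.ofNat (2 * k + 1) l))) with h' | h'
        · exact h'
        · linarith
      rw [h, hks]
      linarith
  · rw [Fintype.sum_option]
    simp only [Option.elim, one_mul]
    have e0 : (Literal.pos none).eval (homVec x) = x none := rfl
    have e1 : ∑ i : Fin (2 * k + 1), (walkLiteral N K i).eval (homVec x)
        = ∑ i : Fin (2 * K + 1), x (some i) + s := by
      have : ∀ i, (walkLiteral N K i).eval (homVec x) = if walkNeg N i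
          then 1 - x (some (Fin.ofNat (2 * K + 1) (walkPos N i)))
          else x (some (Fin.ofNat (2 * K + 1) (walkPos N i))) := by
        intro i
        unfold walkLiteral
        split_ifs <;> rfl
      simp only [this]
      rw [Finset.sum_range] at hsum
      rw [hsum, Finset.sum_range]
      congr 1
      refine Finset.sum_congr rfl fun i _ => ?_
      congr 2
      exact Fin.ext (Nat.mod_eq_of_lt i.isLt)
    rw [e0, e1, hks]
    linarith

/-! ### Rotated labellings of the rim and cyclic arcs -/

section Labelling

lemma fin_sub_val {n : ℕ} (a b : Fin n) :
    ((a - b : Fin n) : ℕ) = if (b : ℕ) ≤ a then (a : ℕ) - b else n + a - b := by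
  split_ifs with h
  · exact Fin.sub_val_of_le h
  · exact Fin.coe_sub_iff_lt.2 (not_le.1 h)

lemma fin_ofNat_succ {n : ℕ} [NeZero n] (m : ℕ) : Fin.ofNat n (m + 1) = Fin.ofNat n m + 1 :=
  Fin.ext (by simp [Fin.val_add])

lemma fin_ofNat_val {n : ℕ} [NeZero n] (a : Fin n) : Fin.ofNat n a = a :=
  Fin.ext (Nat.mod_eq_of_lt a.isLt)

lemma cycleGraph_adj_add {k : ℕ} (hk : 1 ≤ k) (i j r : Fin (2 * k + 1)) :
    (SimpleGraph.cycleGraph (2 * k + 1)).Adj (i + r) (j + r) ↔ CycAdj k i j := by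
  rw [SimpleGraph.cycleGraph_adj', add_sub_add_right_eq_sub, add_sub_add_right_eq_sub,
    fin_sub_val, fin_sub_val]
  unfold CycAdj
  split_ifs <;> omega

lemma ncard_cyclicArc {n : ℕ} (i j : Fin n) : (cyclicArc i j).ncard = (j - i : Fin n) + 1 := by
  have : NeZero n := ⟨by rintro rfl; exact i.elim0⟩
  have h : cyclicArc i j = (fun w => w + i) '' (Set.Iic (j - i)) := by
    ext w
    constructor
    · intro hw
      exact ⟨w - i, hw, sub_add_cancel _ _⟩
    · rintro ⟨u, hu, rfl⟩
      change u + i - i ≤ j - i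
      rwa [add_sub_cancel_right]
  rw [h, Set.ncard_image_of_injective _ (add_left_injective i), Set.ncard_eq_toFinset_card']
  simp

/-- Odd arcs, with no node of `N` inside, end at advances of the walk. -/
lemma walkAdvance_of_odd_arc {k : ℕ} {N : ℕ → Bool}
    (hlast : N (2 * k) = true) {a b : Fin (2 * k + 1)} (hne : a ≠ b) (ha : N a = true)
    (hb : N b = true) (hodd : Odd ((b - a : Fin (2 * k + 1)) : ℕ))
    (harc : ∀ w ∈ cyclicArc a b, N w = true → w = a ∨ w = b) : walkAdvance N b = true := by
  have hmem : ∀ w : Fin (2 * k + 1), w ∈ cyclicArc a b ↔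
      ((w - a : Fin (2 * k + 1)) : ℕ) ≤ ((b - a : Fin (2 * k + 1)) : ℕ) := fun w => Iff.rfl
  have hoff : ∀ w (hw : w < 2 * k + 1), w ≠ a → w ≠ b →
      (((⟨w, hw⟩ : Fin (2 * k + 1)) - a : Fin (2 * k + 1)) : ℕ)
        ≤ ((b - a : Fin (2 * k + 1)) : ℕ) → N w = false := by
    intro w hw h1 h2 h3
    by_contra h
    rcases harc ⟨w, hw⟩ ((hmem _).2 h3) (by simpa using h) with h' | h'
    · exact h1 (congrArg Fin.val h')
    · exact h2 (congrArg Fin.val h')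
  have hne' : (a : ℕ) ≠ b := fun h => hne (Fin.ext h)
  simp only [fin_sub_val] at hodd hoff
  -- An even run of nodes off N is paired within itself. An odd arc has such a run in its interior,
  -- so its end stays unpaired.
  have hpaired : ∀ c m : ℕ, walkPaired N c = false → (∀ l, c ≤ l → l < c + 2 * m → N l = false) →
      walkPaired N (c + 2 * m) = false := by
    intro c m hc hl
    induction m with
    | zero => exact hc
    | succ m ih =>
      have h1 := ih fun l h h' => hl l h (by omega)
      have h2 := hl (c + 2 * m) (by omega) (by omega)
      rw [show c + 2 * (m + 1) = c + 2 * m + 1 + 1 by ring]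
      simp [walkPaired, h1, h2]
  have hp : walkPaired N b = false := by
    rcases Nat.lt_or_ge (a : ℕ) b with hab | hab
    · rw [if_pos hab.le] at hodd hoff
      obtain ⟨m, hm⟩ := hodd
      rw [show (b : ℕ) = (a : ℕ) + 1 + 2 * m by omega]
      refine hpaired _ _ (by simp [walkPaired, ha]) fun l h h' =>
        hoff l (by omega) (by omega) (by omega) ?_
      rw [if_pos (by omega)]
      omega
    · rw [if_neg (by omega)] at hodd hoff
      -- An arc through the origin of the walk cannot have the node 2k of N in its interior, so it
      -- starts there; its other nodes are 0, …, b with b even.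
      have ha2 : (a : ℕ) = 2 * k := by
        by_contra h
        have := hoff (2 * k) (by omega) (Ne.symm h) (by omega) (by
          rw [if_pos (by omega)]
          omega)
        rw [hlast] at this
        cases this
      obtain ⟨m, hm⟩ := hodd
      rw [show (b : ℕ) = 0 + 2 * m by omega]
      refine hpaired _ _ rfl fun l h h' => hoff l (by omega) (by omega) (by omega) ?_
      rw [if_neg (by omega)]
      omega
  simp [walkAdvance, hb, hp]

/-- The cyclic arc that ends at `b` and has no node of `N` inside is unique. -/
lemma cyclicArc_start_unique {n : ℕ} {P : Fin n → Prop} {a a' b : Fin n} (ha : a ≠ b)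
    (ha' : a' ≠ b) (hPa : P a) (hPa' : P a')
    (harc : ∀ w ∈ cyclicArc a b, P w → w = a ∨ w = b)
    (harc' : ∀ w ∈ cyclicArc a' b, P w → w = a' ∨ w = b) : a = a' := by
  by_contra hne
  -- Of two arcs with the same end, the longer contains the start of the shorter.
  have h1 : ¬ a' ∈ cyclicArc a b := fun h => (harc a' h hPa').elim (fun h => hne h.symm) ha'
  have h2 : ¬ a ∈ cyclicArc a' b := fun h => (harc' a h hPa).elim hne ha
  change ¬ ((a' - a : Fin n) : ℕ) ≤ ((b - a : Fin n) : ℕ) at h1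
  change ¬ ((a - a' : Fin n) : ℕ) ≤ ((b - a' : Fin n) : ℕ) at h2
  rw [fin_sub_val, fin_sub_val] at h1 h2
  have : (a : ℕ) ≠ a' := fun h => hne (Fin.ext h)
  split_ifs at h1 h2 <;> omega

variable {U : Type*} {H : SimpleGraph U} {v₀ : U} {k : ℕ} {C : SimpleGraph (Fin (2 * k + 1))}

/-- The labelling of the nodes by the hub `none` and the shifted rim. -/
def hubLabel (φ : C ≃g H.induce ({v₀}ᶜ : Set U)) (r : Fin (2 * k + 1)) :
    Option (Fin (2 * k + 1)) → U
  | none => v₀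
  | some i => φ (i + r)

lemma hubLabel_injective (φ : C ≃g H.induce ({v₀}ᶜ : Set U)) (r : Fin (2 * k + 1)) :
    Function.Injective (hubLabel φ r) := by
  have hne : ∀ i, (φ i : U) ≠ v₀ := fun i => (φ i).2
  rintro (_ | i) (_ | j) h
  · rfl
  · exact absurd h.symm (hne _)
  · exact absurd h (hne _)
  · have := φ.injective (Subtype.ext h)
    rw [add_right_cancel this]

lemma hubLabel_adj (φ : C ≃g H.induce ({v₀}ᶜ : Set U)) (r i j : Fin (2 * k + 1)) :
    H.Adj (hubLabel φ r (some i)) (hubLabel φ r (some j)) ↔ C.Adj (i + r) (j + r) :=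
  φ.map_adj_iff

lemma exists_not_adj_of_ncard_le [Finite U] (φ : C ≃g H.induce ({v₀}ᶜ : Set U))
    (h : (H.neighborSet v₀).ncard ≤ 2 * k) : ∃ r, ¬ H.Adj v₀ (φ r) := by
  by_contra! hall
  have hsub : Set.range (fun i => (φ i : U)) ⊆ H.neighborSet v₀ := by
    rintro _ ⟨i, rfl⟩
    exact hall i
  have h1 := Set.ncard_le_ncard hsub (Set.toFinite _)
  rw [← Set.image_univ, Set.ncard_image_of_injective _
    (fun a b hab => φ.injective (Subtype.ext hab)), Set.ncard_univ, Nat.card_fin] at h1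
  omega

end Labelling

/-! ### The two obstructions -/

theorem not_isLSPlusPerfect_of_isCycleObstruction {V : Type*} [Fintype V] [DecidableEq V]
    (G : SimpleGraph V) {S : Set V} {v₀ : S} {k : ℕ} (hk : 2 ≤ k)
    (h : IsCycleObstruction (G.induce S) v₀ k) : ¬ IsLSPlusPerfect G := by
  classical
  obtain ⟨φ, -, hdeg, hcard⟩ := h
  obtain ⟨D, D', ⟨hD, hDo⟩, ⟨hD', hDo'⟩, hne⟩ := (Set.one_lt_ncard_iff (Set.toFinite _)).1 hcard
  obtain ⟨i, j, hij, hi, hj, harc, rfl⟩ := hD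
  obtain ⟨i', j', hij', hi', hj', harc', rfl⟩ := hD'
  obtain ⟨q, hq⟩ := exists_not_adj_of_ncard_le φ hdeg
  -- The walk must start at a non-neighbour preceded by a neighbour. Without such a place, adjacency
  -- would spread from i around the whole rim, contradicting the non-neighbour q.
  obtain ⟨r, hr, hr'⟩ : ∃ r, (G.induce S).Adj v₀ (φ r) ∧ ¬ (G.induce S).Adj v₀ (φ (r + 1)) := by
    by_contra! hall
    refine hq ?_
    have : ∀ m : ℕ, (G.induce S).Adj v₀ (φ (i + Fin.ofNat _ m)) := by
      intro m
      induction m with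
      | zero => exact (add_zero i).symm ▸ hi
      | succ m ih =>
        have := hall _ ih
        rwa [add_assoc, ← fin_ofNat_succ] at this
    have := this (q - i : Fin (2 * k + 1))
    rwa [fin_ofNat_val, add_sub_cancel] at this
  set s := r + 1 with hs
  let N : ℕ → Bool := fun l => decide ((G.induce S).Adj v₀ (φ (Fin.ofNat _ l + s)))
  have hN : ∀ l : Fin (2 * k + 1), N l = true ↔ (G.induce S).Adj v₀ (φ (l + s)) := by
    intro l
    simp only [N, fin_ofNat_val, decide_eq_true_eq]
  have h0 : N 0 = false := by
    rw [← zero_add s] at hr'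
    exact decide_eq_false hr'
  have hlast : N (2 * k) = true := by
    have h2k : Fin.ofNat (2 * k + 1) (2 * k) + s = r := by
      have h1 : Fin.ofNat (2 * k + 1) (2 * k) + 1 = 0 := by
        rw [← fin_ofNat_succ]
        exact Fin.ext (Nat.mod_self _)
      rw [hs, add_comm r 1, ← add_assoc, h1, zero_add]
    simp only [N, h2k, hr, decide_true]
  have hadv : ∀ i j : Fin (2 * k + 1), i ≠ j → (G.induce S).Adj v₀ (φ i) →
      (G.induce S).Adj v₀ (φ j) →
      (∀ w ∈ cyclicArc i j, (G.induce S).Adj v₀ (φ w) → w = i ∨ w = j) →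
      Odd (insert v₀ ((fun w => (φ w : S)) '' cyclicArc i j)).ncard →
      walkAdvance N (j - s : Fin (2 * k + 1)) = true := by
    intro i j hij hi hj harc hodd
    refine walkAdvance_of_odd_arc (a := i - s) hlast ?_ ?_ ?_ ?_ ?_
    · exact fun h => hij (sub_left_injective h)
    · rw [hN, sub_add_cancel]
      exact hi
    · rw [hN, sub_add_cancel]
      exact hj
    · rw [sub_sub_sub_cancel_right]
      rw [Set.ncard_insert_of_notMem (by rintro ⟨w, -, hw⟩; exact (φ w).2 hw) (Set.toFinite _),
        Set.ncard_image_of_injective _ (fun a b hab => φ.injective (Subtype.ext hab)),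
        ncard_cyclicArc] at hodd
      obtain ⟨m, hm⟩ := hodd
      -- The central cycle has (j - i) + 2 nodes: those of the arc, both ends included, and the hub.
      exact ⟨m - 1, by omega⟩
    · intro w hw hNw
      rw [hN] at hNw
      have hw' : w + s ∈ cyclicArc i j := by
        change w - (i - s) ≤ (j - s) - (i - s) at hw
        rw [sub_sub_sub_cancel_right, sub_sub_eq_add_sub] at hw
        exact hw
      rcases harc _ hw' hNw with h | h
      · exact Or.inl (eq_sub_of_add_eq h)
      · exact Or.inr (eq_sub_of_add_eq h)
  have ha := hadv i j hij hi hj harc hDo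
  have ha' := hadv i' j' hij' hi' hj' harc' hDo'
  -- Arcs with equal ends have equal starts, so distinct central cycles give distinct advances.
  have hjj : ((j - s : Fin (2 * k + 1)) : ℕ) ≠ (j' - s : Fin (2 * k + 1)) := by
    intro h
    obtain rfl : j = j' := sub_left_injective (Fin.ext h)
    exact hne (by rw [cyclicArc_start_unique (P := fun w => (G.induce S).Adj v₀ (φ w))
      hij hij' hi hi' harc harc'])
  have hinj : Function.Injective fun o => ((hubLabel φ s o : S) : V) :=
    Subtype.val_injective.comp (hubLabel_injective φ s)
  have hadj : ∀ a b : Fin (2 * k + 1),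
      G.Adj (hubLabel φ s (some a) : S) (hubLabel φ s (some b) : S) ↔ CycAdj k a b := by
    intro a b
    rw [← cycleGraph_adj_add (by omega) a b s, ← hubLabel_adj φ]
    rfl
  have hNa : ∀ a : Fin (2 * k + 1),
      G.Adj (hubLabel φ s none : S) (hubLabel φ s (some a) : S) ↔ N a = true := by
    intro a
    rw [hN]
    rfl
  rcases lt_or_gt_of_ne hjj with hlt | hlt
  · exact not_isLSPlusPerfect_of_wheel hinj hadj hNa h0 hlast hlt (by omega) ha ha'
  · exact not_isLSPlusPerfect_of_wheel hinj hadj hNa h0 hlast hlt (by omega) ha' ha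

/-- After a rotation placing a non-neighbour of the hub at 0, the graph is a subgraph of the
antiwheel minus a spoke on the same nodes, so every node keeps its own variable; α = 2 makes the
violated inequality valid. -/
theorem not_isLSPlusPerfect_of_isAntiholeObstruction {V : Type*} [Fintype V] [DecidableEq V]
    (G : SimpleGraph V) {S : Set V} {v₀ : S} {k : ℕ} (hk : 2 ≤ k)
    (h : IsAntiholeObstruction (G.induce S) v₀ k) : ¬ IsLSPlusPerfect G := by
  classical
  obtain ⟨⟨φ⟩, -, hdeg, hα⟩ := h
  obtain ⟨r, hr⟩ := exists_not_adj_of_ncard_le φ hdeg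
  obtain ⟨x, hx, hlt⟩ := exists_mem_LSPlus_antiwheelMinusSpoke hk
  have hhub : ∀ i : Fin (2 * k + 1), (G.induce S).Adj v₀ (hubLabel φ r (some i)) →
      (i : ℕ) ≠ 0 := by
    rintro i hi h0
    obtain rfl : i = 0 := Fin.ext h0
    exact hr (by simpa [hubLabel] using hi)
  refine not_isLSPlusPerfect_of_literals (g := fun o => ((hubLabel φ r o : S) : V))
    (Subtype.val_injective.comp (hubLabel_injective φ r)) (B := antiwheelMinusSpoke k)
    (L := .pos) ?_ hx (fun _ => 1) 2 ?_ ?_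
  · rintro (_ | i) (_ | j) h
    · exact absurd h (G.loopless.irrefl _)
    · exact hhub j h
    · exact hhub i h.symm
    · have h' : ((SimpleGraph.cycleGraph (2 * k + 1))ᶜ).Adj (i + r) (j + r) :=
        (hubLabel_adj φ r i j).1 h
      rw [SimpleGraph.compl_adj, cycleGraph_adj_add (by omega)] at h'
      exact ⟨fun hij => h'.1 (by rw [hij]), h'.2⟩
  · intro T hT
    let A : Finset (Option (Fin (2 * k + 1))) :=
      Finset.univ.filter fun o => ((hubLabel φ r o : S) : V) ∈ T
    have hsum : ∑ o, 1 * T.indicator (1 : V → ℝ) (hubLabel φ r o : S) = A.card := by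
      simp [A, Set.indicator_apply]
    have hind : (G.induce S).IsIndepSet (A.image (hubLabel φ r) : Finset S) := by
      intro u hu v hv huv
      simp only [Finset.coe_image, Set.mem_image, Finset.mem_coe, A, Finset.mem_filter,
        Finset.mem_univ, true_and] at hu hv
      obtain ⟨a, ha, rfl⟩ := hu
      obtain ⟨b, hb, rfl⟩ := hv
      exact hT ha hb fun h => huv (Subtype.ext h)
    have hcard := hind.card_le_indepNum
    rw [Finset.card_image_of_injective _ (hubLabel_injective φ r), hα] at hcard
    rw [hsum]
    exact_mod_cast hcard
  · rw [Fintype.sum_option]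
    simp only [one_mul]
    exact hlt.trans_eq (add_comm _ _)

end LovaszSchrijver

theorem mainTheorem9 {V : Type*} [Fintype V] [DecidableEq V] (G : SimpleGraph V)
    (hG : LovaszSchrijver.IsLSPlusPerfect G) :
    ¬ ∃ (S : Set V) (v₀ : S) (k : ℕ), 2 ≤ k ∧
      (LovaszSchrijver.IsCycleObstruction (G.induce S) v₀ k ∨
        LovaszSchrijver.IsAntiholeObstruction (G.induce S) v₀ k) := by
  rintro ⟨S, v₀, k, hk, h | h⟩
  · exact LovaszSchrijver.not_isLSPlusPerfect_of_isCycleObstruction G hk h hG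
  · exact LovaszSchrijver.not_isLSPlusPerfect_of_isAntiholeObstruction G hk h hG
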